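/- **Setting.** For non-zero integers $n_1,\dots,n_k$ let $C[n_1,\dots,n_k]$ be the Conway diagram with four vertical strands, numbered $1,2,3,4$ from left to right. Caps at the top join strands $1,2$ and $3,4$. Descending, the blocks of $|n_1|,\dots,|n_k|$ half twists follow one another: the odd-numbered blocks twist the strands at positions $2,3$, right-handed iff $n_i>0$, and the even-numbered blocks twist the strands at positions $1,2$, right-handed iff $n_i<0$. In a right-handed half twist the over-strand runs between the upper right and the lower left. Caps at the bottom join positions $1,2$ and $3,4$ if $k$ is odd, and $1,4$ and $2,3$ if $k$ is even. Write $\frac{1}{n_1+\frac{1}{n_2+\cdots+\frac1{n_k}}}=\frac{\beta}{\alpha}$ with coprime $\alpha\ge 0$ and $\beta$ (where $\alpha=0$ stands for the value $\infty$). The diagram represents a 2-bridge knot $K$ if it has exactly one component and is not a diagram of the trivial knot, i.e. $\alpha>1$. **Rep-polynomial.** Orient $K$. Let $a,b$ be a basis of a free $\mathbb Z[u]$-module of rank $2$ with the antisymmetric bilinear form such that $\langle a,b\rangle=u$. Give the vectors $a,a,b,b$ to the four strands at the top and descend. At each crossing the vector $y$ of the over-strand is kept, and the vector $x$ of the under-strand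 is replaced by $-(x+s\langle x,y\rangle y)$, where $s=1$ if the half twist is right-handed and the over-strand runs downward, and changing the handedness, or the direction of the over-strand, changes the sign of $s$. Let $x_1,x_2,x_3,x_4=b$ be the vectors at the bottom. The rep-polynomial $P_K(u)\in\mathbb Z[u]$ of the diagram is $\pm\langle x_3,x_4\rangle$ if $k$ is odd and $\pm\langle x_1,x_4\rangle$ if $k$ is even, with the sign that makes its leading coefficient positive. **Representations.** Let $G(K)$ be the knot group, given by the Wirtinger presentation of the diagram: at each crossing the under-arcs $x$ above and $z$ below and the over-arc $y$ satisfy $z=y^{-s}xy^{s}$, with $s$ as above. Let $\mathsf a,\mathsf b\in G(K)$ be the meridians of the arcs through the left and the right cap at the top. A representation $\rho:G(K)\to SL(2,\mathbb C)$ is parabolic if $\operatorname{tr}\rho(m)=2$ for every meridian $m$, and non-abelian if its image is not commutative. Representations are considered up to conjugation in $SL(2,\mathbb C)$. **Theorem.** Let $C[n_1,\dots,n_k]$, with all $n_i\neq0$, be an oriented Conway diagram of a 2-bridge knot $K$, and let $P_K(u)$ be its rep-polynomial. Then there is a $g\in\mathbb Z[u]$ such that $$P_K(u)=u\,g(u)\,\hat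 g(u),\qquad \hat g(u)=(-1)^{\deg g}g(-u),\qquad \hat g\neq g,$$ and such that there is a bijection from the set of the roots of $g$ in $\mathbb C$ onto the set of the conjugacy classes of non-abelian parabolic representations $\rho: G(K)\to SL(2,\mathbb C)$. This bijection sends a root $r$ to the class of the representation with $$\rho(\mathsf a)=\begin{pmatrix}1&1\\0&1\end{pmatrix},\qquad \rho(\mathsf b)=\begin{pmatrix}1&0\\-r^2&1\end{pmatrix}.$$ -/

import Mathlib

open Polynomial

namespace TwoBridge

/-! ### Conway diagrams

The Conway diagram `C[n₁, …, n_k]` is drawn as four vertical strands, at the positions `0, 1, 2, 3`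
from left to right.  Two caps at the top join the positions `0, 1` and `2, 3`.  Descending, one
meets the blocks of half twists one after another: the odd-numbered blocks twist the two
middle strands, the even-numbered blocks twist the two leftmost strands, and the strand at
position `3` is never moved.  Two caps at the bottom close the diagram. -/

/-- One crossing of the diagram: a half twist, right- or left-handed, of the strands at
positions `1, 2` (`middle = true`) or `0, 1` (`middle = false`). -/
structure Crossing where
  middle : Bool
  rightHanded : Bool

namespace Crossing

/-- The left one of the two positions involved. -/
def left (c : Crossing) : Fin 4 := if c.middle then 1 else 0

/-- The right one of the two positions involved. -/
def right (c : Crossing) : Fin 4 := if c.middle then 2 else 1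

/-- The position of the over-strand just above the crossing.  In a right-handed half twist of
vertical strands the over-strand runs between the upper right and the lower left. -/
def overPos (c : Crossing) : Fin 4 := if c.rightHanded then c.right else c.left

/-- The position of the under-strand just above the crossing.  Just below the crossing the
over-strand is at `underPos` and the under-strand is at `overPos`. -/
def underPos (c : Crossing) : Fin 4 := if c.rightHanded then c.left else c.right

/-- The permutation of positions made by the crossing. -/
def perm (c : Crossing) : Equiv.Perm (Fin 4) := Equiv.swap c.left c.right

/-- `1` for a right-handed half twist and `-1` for a left-handed one. -/
def sign (c : Crossing) : ℤˣ := if c.rightHanded then 1 else -1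

end Crossing

/-- The crossings of consecutive blocks, the first of which is in the middle iff `mid`.  A block
with entry `n` has `|n|` crossings; they are right-handed iff `0 < n` for a middle
(odd-numbered) block, and iff `n < 0` for a left (even-numbered) block. -/
def blocks : Bool → List ℤ → List Crossing
  | _, [] => []
  | mid, n :: ns =>
      List.replicate n.natAbs ⟨mid, if mid then decide (0 < n) else decide (n < 0)⟩ ++
        blocks (!mid) ns

/-- The crossings of `C[n₁, …, n_k]`, from top to bottom. -/
def crossings (ns : List ℤ) : List Crossing := blocks true ns

/-- The caps at the top: `0, 1` and `2, 3` are joined. -/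
def topCap : Equiv.Perm (Fin 4) := Equiv.swap 0 1 * Equiv.swap 2 3

/-- The caps at the bottom: `0, 1` and `2, 3` are joined if `k` is odd, while `0, 3` and `1, 2`
are joined if `k` is even. -/
def bottomCap (ns : List ℤ) : Equiv.Perm (Fin 4) :=
  if Odd ns.length then Equiv.swap 0 1 * Equiv.swap 2 3 else Equiv.swap 0 3 * Equiv.swap 1 2

/-- `carry cs p` is the position, below all the crossings `cs`, of the strand that is at the
position `p` above them. -/
def carry : List Crossing → Equiv.Perm (Fin 4)
  | [] => 1
  | c :: cs => carry cs * c.perm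

/-- The bottom caps, read on the positions at the top. -/
def bottomCapAtTop (ns : List ℤ) : Equiv.Perm (Fin 4) :=
  (carry (crossings ns))⁻¹ * bottomCap ns * carry (crossings ns)

/-- The diagram `C[n₁, …, n_k]` has exactly one component: one gets from any of the four strands
to any other one through the caps at the top and at the bottom. -/
def IsKnot (ns : List ℤ) : Prop :=
  MulAction.IsPretransitive (Subgroup.closure {topCap, bottomCapAtTop ns}) (Fin 4)

/-- The pair `(β, α)` with `β / α = 1 / (n₁ + 1 / (n₂ + ⋯ + 1 / n_k))`, up to a common sign;
`α = 0` stands for the value `∞`.  The entries are always coprime. -/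
def slope : List ℤ → ℤ × ℤ
  | [] => (0, 1)
  | n :: ns => ((slope ns).2, n * (slope ns).2 + (slope ns).1)

/-- The number `α` of the two-bridge link `S(α, β)` with the diagram `C[n₁, …, n_k]`. -/
def alpha (ns : List ℤ) : ℕ := (slope ns).2.natAbs

/-- The diagram `C[n₁, …, n_k]` (with non-zero entries) represents a two-bridge knot: it has one
component and is not a diagram of the trivial knot, which is `S(1, β)`. -/
def IsTwoBridgeKnot (ns : List ℤ) : Prop :=
  (∀ n ∈ ns, n ≠ 0) ∧ IsKnot ns ∧ 1 < alpha ns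

/-- An orientation of the diagram: `dir p` is `1` or `-1` according to whether the strand that is
at position `p` at the top runs downward or upward.  The two strands which meet in a cap have
opposite directions. -/
structure Orientation (ns : List ℤ) where
  dir : Fin 4 → ℤˣ
  dir_topCap : ∀ p, dir (topCap p) = -dir p
  dir_bottomCap : ∀ p, dir (bottomCapAtTop ns p) = -dir p

/-! ### The rep-polynomial -/

/-- A vector `f a + g b`, given by `(f, g)`, in the free `ℤ[u]`-module on the two vectors
`a`, `b` of the bridges at the top. -/
abbrev Vec : Type := ℤ[X] × ℤ[X]

/-- The antisymmetric bilinear form with `⟨a, b⟩ = u`. -/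
noncomputable def form (v w : Vec) : ℤ[X] := X * (v.1 * w.2 - v.2 * w.1)

/-- The symplectic quandle operation `v ▷ w = v + ⟨v, w⟩ w` (for `s = 1`) or its inverse
`v ▷⁻¹ w = v - ⟨v, w⟩ w` (for `s = -1`). -/
noncomputable def quandleOp (s : ℤˣ) (v w : Vec) : Vec :=
  v + ((((s : ℤˣ) : ℤ) : ℤ[X]) * form v w) • w

/-- The vectors below a crossing, from the directions `dir` and the vectors `v` at the four
positions above it.  The vector `w` of the over-strand is kept, and the vector `v` of the
under-strand becomes `-(v ▷ w)` or `-(v ▷⁻¹ w)`; it is the first for a right-handed half twist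
whose over-strand runs downward, and each of handedness and direction changes the sign of the
exponent. -/
noncomputable def passCrossing (c : Crossing) (dir : Fin 4 → ℤˣ) (v : Fin 4 → Vec) :
    Fin 4 → Vec :=
  Function.update (Function.update v c.underPos (v c.overPos)) c.overPos
    (-quandleOp (c.sign * dir c.overPos) (v c.underPos) (v c.overPos))

/-- The vectors at the four positions below all the crossings. -/
noncomputable def descend : List Crossing → (Fin 4 → ℤˣ) → (Fin 4 → Vec) → Fin 4 → Vec
  | [], _, v => v
  | c :: cs, dir, v => descend cs (dir ∘ c.perm) (passCrossing c dir v)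

/-- The vectors at the bottom, when one starts with `a, a, b, b` at the top. -/
noncomputable def bottomVec (ns : List ℤ) (o : Orientation ns) : Fin 4 → Vec :=
  descend (crossings ns) o.dir ![(1, 0), (1, 0), (0, 1), (0, 1)]

/-- The rep-polynomial before its sign is chosen: `⟨b_{k,f}, b⟩` for odd `k` and `⟨a_{k,f}, b⟩`
for even `k`, where `a_{k,f}, b_{k,f}` are the last left and right vectors of the last block.
They are the vectors at the positions `1, 2` for odd `k` and `0, 1` for even `k`, and the vector
at position `3` is always `b`. -/
noncomputable def rawRepPoly (ns : List ℤ) (o : Orientation ns) : ℤ[X] :=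
  if Odd ns.length then form (bottomVec ns o 2) (bottomVec ns o 3)
  else form (bottomVec ns o 0) (bottomVec ns o 3)

/-- The rep-polynomial `P_K(u)` of the oriented diagram `K = C[n₁, …, n_k]`; the sign is chosen
so that the leading coefficient is positive. -/
noncomputable def repPoly (ns : List ℤ) (o : Orientation ns) : ℤ[X] :=
  if 0 < (rawRepPoly ns o).leadingCoeff then rawRepPoly ns o else -rawRepPoly ns o

/-- `ĝ(u) = (-1) ^ deg g * g(-u)`. -/
noncomputable def hat (g : ℤ[X]) : ℤ[X] := (-1) ^ g.natDegree * g.comp (-X)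

/-! ### The knot group -/

/-- The number of crossings. -/
abbrev numCrossings (ns : List ℤ) : ℕ := (crossings ns).length

/-- The pieces into which the strands are cut by horizontal lines that separate the crossings:
`(t, p)` is the piece at position `p` below the first `t` crossings. -/
abbrev Piece (ns : List ℤ) : Type := Fin (numCrossings ns + 1) × Fin 4

/-- The direction (`1` for downward) of a piece. -/
def pieceDir (ns : List ℤ) (o : Orientation ns) (e : Piece ns) : ℤˣ :=
  o.dir ((carry ((crossings ns).take e.1)).symm e.2)

open FreeGroup in
/-- The Wirtinger relators of the diagram.  There is one generator for each piece; the generators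
of pieces of one arc are identified, and at each crossing the two arcs `x`, `z` of the
under-strand, above and below the crossing, and the arc `y` of the over-strand satisfy
`z = y⁻¹ x y` or `z = y x y⁻¹`, according to the handedness and the direction of the
over-strand. -/
inductive IsRelator (ns : List ℤ) (o : Orientation ns) : FreeGroup (Piece ns) → Prop
  | top (p : Fin 4) : IsRelator ns o (of (0, topCap p) * (of (0, p))⁻¹)
  | bottom (p : Fin 4) :
      IsRelator ns o (of (Fin.last _, bottomCap ns p) * (of (Fin.last _, p))⁻¹)
  | straight (t : Fin (numCrossings ns)) (p : Fin 4)
      (h₁ : p ≠ ((crossings ns).get t).left) (h₂ : p ≠ ((crossings ns).get t).right) :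
      IsRelator ns o (of (t.succ, p) * (of (t.castSucc, p))⁻¹)
  | over (t : Fin (numCrossings ns)) :
      IsRelator ns o (of (t.succ, ((crossings ns).get t).underPos) *
        (of (t.castSucc, ((crossings ns).get t).overPos))⁻¹)
  | under (t : Fin (numCrossings ns)) (s : ℤˣ)
      (hs : s = ((crossings ns).get t).sign *
        pieceDir ns o (t.castSucc, ((crossings ns).get t).overPos)) :
      IsRelator ns o (of (t.succ, ((crossings ns).get t).overPos) *
        (of (t.castSucc, ((crossings ns).get t).overPos) ^ (-(s : ℤ)) *
          of (t.castSucc, ((crossings ns).get t).underPos) *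
          of (t.castSucc, ((crossings ns).get t).overPos) ^ (s : ℤ))⁻¹)

/-- The knot group `G(K)`, by its Wirtinger presentation. -/
abbrev KnotGroup (ns : List ℤ) (o : Orientation ns) : Type :=
  PresentedGroup {r : FreeGroup (Piece ns) | IsRelator ns o r}

/-- The meridian of the arc that contains a given piece. -/
def arc (ns : List ℤ) (o : Orientation ns) (e : Piece ns) : KnotGroup ns o :=
  PresentedGroup.of e

/-- The meridians: the conjugates of the Wirtinger generators. -/
def IsMeridian (ns : List ℤ) (o : Orientation ns) (m : KnotGroup ns o) : Prop :=
  ∃ (e : Piece ns) (h : KnotGroup ns o), m = h * arc ns o e * h⁻¹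

/-! ### Parabolic representations -/

/-- `SL(2, ℂ)`. -/
abbrev SL2C : Type := Matrix.SpecialLinearGroup (Fin 2) ℂ

/-- The representation is parabolic: meridians are sent to matrices of trace `2`. -/
def IsParabolic (ns : List ℤ) (o : Orientation ns) (ρ : KnotGroup ns o →* SL2C) : Prop :=
  ∀ m, IsMeridian ns o m → (ρ m : Matrix (Fin 2) (Fin 2) ℂ).trace = 2

/-- The image of the representation is not commutative. -/
def IsNonabelian (ns : List ℤ) (o : Orientation ns) (ρ : KnotGroup ns o →* SL2C) : Prop :=
  ∃ x y, ρ x * ρ y ≠ ρ y * ρ x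

/-- The non-abelian parabolic representations of the knot group. -/
def ParabolicRep (ns : List ℤ) (o : Orientation ns) : Type :=
  {ρ : KnotGroup ns o →* SL2C // IsParabolic ns o ρ ∧ IsNonabelian ns o ρ}

/-- Conjugacy of representations in `SL(2, ℂ)`. -/
instance parabolicRepSetoid (ns : List ℤ) (o : Orientation ns) : Setoid (ParabolicRep ns o) where
  r ρ σ := ∃ A : SL2C, ∀ x, σ.1 x = A * ρ.1 x * A⁻¹
  iseqv :=
    { refl := fun ρ => ⟨1, fun x => by simp⟩
      symm := by
        rintro ρ σ ⟨A, hA⟩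
        exact ⟨A⁻¹, fun x => by rw [hA]; group⟩
      trans := by
        rintro ρ σ τ ⟨A, hA⟩ ⟨B, hB⟩
        exact ⟨B * A, fun x => by rw [hB, hA]; group⟩ }

/-- The non-abelian parabolic representations up to conjugacy. -/
def ParabolicRepClass (ns : List ℤ) (o : Orientation ns) : Type :=
  Quotient (parabolicRepSetoid ns o)

end TwoBridge

/-! Everything is done up to sign. An invertible map `Q` with `Q b = ±w` conjugates the transvection
along `b`, the vector of the last strand, to the transvection along `w`, or to its inverse if `det Q
= -1`. The four vectors are therefore lifted to four "half-turns" `P p` in `GL(2, ℤ[u])`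
(`IsTurnSystem`): `P p` has square `±1` and sends `b` to `±v p`, while `P 3 = 1` and `P 0 * P 1 * P
2 = ±T` with a transvection `T` along `b`. At a crossing the half-turn of the under-strand is
conjugated by that of the over-strand or its inverse. This keeps the product, and on vectors it is
the quandle operation: half-turn identities rewrite the conjugate as a conjugate of `T^±1`, times
the old half-turn, times `T^±1`, and `T` fixes `b`.

In a knot, the strand that meets the last strand at the bottom starts in the left top cap, so its
half-turn at the bottom is `d E d⁻¹`, where `E` exchanges `a` and `b`. With `d⁻¹ b = (f, h)` this
gives `P_K = ±⟨E d⁻¹ b, d⁻¹ b⟩ = ±u (h² - f²)`. On all half-turns, hence on `d`, the substitution `u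
↦ -u` acts up to sign as conjugation by the reflection `b ↦ -b`. So `f` and `h` have opposite
parities, and `g = h + f` has `ĝ = ±(h - f)`. Being a column of an invertible matrix, `f, h` are
coprime, so `g` and `ĝ` have no common root.

If `ĝ = g`, then `f` or `h` is zero and the other a unit, so `P_K = u`. This is excluded modulo two,
where the vectors become pairs of Chebyshev polynomials numbered by integers, a crossing acts by `m
↦ 2n - m`, the numbers follow the continued fraction, and `P_K ≡ u S_{α-1}(u)` has degree `α > 1`.

A parabolic matrix is the transvection along a vector given up to sign, and a non-commuting pair can
be normalised to the vectors `(1, 0)`, `(0, r)`, with `r²` an invariant. The images of the arcs are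
then given by the diagram vectors at `u = r`, and a bottom cap forces `P_K(r) = 0`. Conversely, at a
root `r ≠ 0` the half-turns close both bottom caps. Exactly one of `±r` is a root of `g`. -/

namespace TwoBridge

/-! ### Linear maps of the module of vectors -/

/-- The substitution `u ↦ -u`. -/
noncomputable def negArg : ℤ[X] →+* ℤ[X] := compRingHom (-X)

theorem negArg_apply (p : ℤ[X]) : negArg p = p.comp (-X) := rfl

@[simp] theorem negArg_X : negArg X = -X := by simp [negArg_apply]

/-- The invertible linear maps of the module of vectors, with respect to the basis `a`, `b`. -/
abbrev Lin : Type := GL (Fin 2) ℤ[X]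

/-- The action of a matrix on a vector. -/
noncomputable def act (M : Lin) (v : Vec) : Vec :=
  (M 0 0 * v.1 + M 0 1 * v.2, M 1 0 * v.1 + M 1 1 * v.2)

theorem act_mul (M N : Lin) (v : Vec) : act (M * N) v = act M (act N v) := by
  ext1 <;> simp [act, Matrix.mul_apply, Fin.sum_univ_two] <;> ring

@[simp] theorem act_one (v : Vec) : act 1 v = v := by
  ext1 <;> simp [act]

theorem act_neg (M : Lin) (v : Vec) : act (-M) v = -act M v := by
  ext1 <;> simp [act] <;> ring

theorem act_neg_vec (M : Lin) (v : Vec) : act M (-v) = -act M v := by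
  ext1 <;> simp [act] <;> ring

theorem det_two (M : Lin) :
    (M : Matrix (Fin 2) (Fin 2) ℤ[X]).det = M 0 0 * M 1 1 - M 0 1 * M 1 0 :=
  Matrix.det_fin_two _

/-- The sign `1` or `-1` as a polynomial. -/
noncomputable def signPoly (s : ℤˣ) : ℤ[X] := ((s : ℤ) : ℤ[X])

@[simp] theorem signPoly_one : signPoly 1 = 1 := by simp [signPoly]
@[simp] theorem signPoly_neg (s : ℤˣ) : signPoly (-s) = -signPoly s := by simp [signPoly]
theorem signPoly_mul (s t : ℤˣ) : signPoly (s * t) = signPoly s * signPoly t := by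
  simp [signPoly]
theorem signPoly_mul_self (s : ℤˣ) : signPoly s * signPoly s = 1 := by
  rw [← signPoly_mul, Int.units_mul_self, signPoly_one]

theorem form_act (M : Lin) (v w : Vec) :
    form (act M v) (act M w) = (M : Matrix (Fin 2) (Fin 2) ℤ[X]).det * form v w := by
  simp only [form, act, det_two]; ring

/-- The transvection along `b`, or its inverse. -/
noncomputable def transB (s : ℤˣ) : Lin where
  val := !![1, 0; signPoly s * X, 1]
  inv := !![1, 0; -(signPoly s * X), 1]
  val_inv := by ext i j : 2; fin_cases i <;> fin_cases j <;> simp [Matrix.mul_apply]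
  inv_val := by ext i j : 2; fin_cases i <;> fin_cases j <;> simp [Matrix.mul_apply]

theorem transB_inv (s : ℤˣ) : (transB s)⁻¹ = transB (-s) := by
  ext i j : 3; fin_cases i <;> fin_cases j <;> simp [transB]

theorem act_transB (s : ℤˣ) (v : Vec) : act (transB s) v = quandleOp s v (0, 1) := by
  ext1 <;> simp [act, quandleOp, form, transB, signPoly] ; ring

theorem act_transB_b (s : ℤˣ) : act (transB s) (0, 1) = (0, 1) := by
  ext1 <;> simp [act, transB]

/-- A transvection along `Q b` is a conjugate of a transvection along `b`. -/
theorem act_conj_transB (Q : Lin) (e s : ℤˣ)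
    (hQ : (Q : Matrix (Fin 2) (Fin 2) ℤ[X]).det = signPoly e) (v : Vec) :
    act (Q * transB (s * e) * Q⁻¹) v = quandleOp s v (act Q (0, 1)) := by
  obtain ⟨x, rfl⟩ : ∃ x, v = act Q x := ⟨act Q⁻¹ v, by rw [← act_mul]; simp⟩
  rw [act_mul, act_mul, ← act_mul Q⁻¹, inv_mul_cancel, act_one, act_transB]
  -- A map of determinant `e` multiplies the form by `e`; this is the factor `e` in the exponent.
  simp only [quandleOp, form_act, hQ]
  ext1 <;> simp [act, signPoly] <;> ring

theorem quandleOp_neg_left (s : ℤˣ) (v w : Vec) : quandleOp s (-v) w = -quandleOp s v w := by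
  ext1 <;> simp [quandleOp, form] <;> ring

theorem quandleOp_neg_right (s : ℤˣ) (v w : Vec) : quandleOp s v (-w) = quandleOp s v w := by
  ext1 <;> simp [quandleOp, form] <;> ring

/-! ### Equality up to sign -/

/-- Equality up to sign. -/
def EqSign {α : Type*} [Neg α] (x y : α) : Prop := x = y ∨ x = -y

namespace EqSign

variable {α : Type*} [InvolutiveNeg α] {x y z : α}

theorem refl (x : α) : EqSign x x := Or.inl rfl

theorem symm (h : EqSign x y) : EqSign y x := by
  rcases h with rfl | rfl
  · exact refl _
  · exact Or.inr (neg_neg _).symm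

theorem trans (h : EqSign x y) (h' : EqSign y z) : EqSign x z := by
  rcases h with rfl | rfl <;> rcases h' with rfl | rfl
  · exact refl _
  · exact Or.inr rfl
  · exact Or.inr rfl
  · exact Or.inl (neg_neg _)

theorem neg_left (h : EqSign x y) : EqSign (-x) y := by
  rcases h with rfl | rfl
  · exact Or.inr rfl
  · exact Or.inl (neg_neg _)

end EqSign

theorem EqSign.act {M N : Lin} {v w : Vec} (hM : EqSign M N) (hv : EqSign v w) :
    EqSign (act M v) (act N w) := by
  rcases hM with rfl | rfl <;> rcases hv with rfl | rfl <;>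
    simp [EqSign, act_neg, act_neg_vec]

theorem EqSign.quandleOp {s : ℤˣ} {v v' w w' : Vec} (hv : EqSign v v') (hw : EqSign w w') :
    EqSign (quandleOp s v w) (quandleOp s v' w') := by
  rcases hv with rfl | rfl <;> rcases hw with rfl | rfl <;>
    simp [EqSign, quandleOp_neg_left, quandleOp_neg_right]

theorem EqSign.mul {G : Type*} [Mul G] [HasDistribNeg G] {x x' y y' : G} (hx : EqSign x x')
    (hy : EqSign y y') : EqSign (x * y) (x' * y') := by
  rcases hx with rfl | rfl <;> rcases hy with rfl | rfl <;> simp [EqSign]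

theorem EqSign.inv {G : Type*} [Group G] [HasDistribNeg G] {x x' : G} (hx : EqSign x x') :
    EqSign x⁻¹ x'⁻¹ := by
  rcases hx with rfl | rfl <;> simp [EqSign, inv_neg]

/-! ### The group of maps compatible with `u ↦ -u` -/

/-- The reflection that fixes `a` and negates `b`. -/
noncomputable def reflB : Lin where
  val := !![1, 0; 0, -1]
  inv := !![1, 0; 0, -1]
  val_inv := by ext i j : 2; fin_cases i <;> fin_cases j <;> simp [Matrix.mul_apply]
  inv_val := by ext i j : 2; fin_cases i <;> fin_cases j <;> simp [Matrix.mul_apply]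

/-- The substitution `u ↦ -u` followed by the conjugation with `reflB`. -/
noncomputable def flip : Lin →* Lin :=
  (MulAut.conj reflB).toMonoidHom.comp (Units.map (negArg.mapMatrix : _ →+* _).toMonoidHom)

theorem flip_apply (M : Lin) (i j : Fin 2) :
    flip M i j = if i = j then negArg (M i j) else -negArg (M i j) := by
  fin_cases i <;> fin_cases j <;>
    simp [flip, reflB, Matrix.mul_apply, Fin.sum_univ_two, Matrix.vecMul, dotProduct]

/-- The maps which `u ↦ -u` changes, up to sign, by the conjugation with `reflB`. -/
noncomputable def symmetricLin : Subgroup Lin where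
  carrier := {c | EqSign (flip c) c}
  one_mem' := Or.inl (map_one _)
  mul_mem' ha hb := by
    rw [Set.mem_ofPred_eq, map_mul]; exact EqSign.mul ha hb
  inv_mem' ha := by
    rw [Set.mem_ofPred_eq, map_inv]; exact EqSign.inv ha

theorem mem_symmetricLin {c : Lin} : c ∈ symmetricLin ↔ EqSign (flip c) c := Iff.rfl

/-! ### Half-turns and the crossings -/

section Group

variable {G : Type*} [Group G] [HasDistribNeg G] {p q r : G}

/-- In either case these are rewriting rules that reduce words in half-turns, so identities up to
sign become a finite case check. -/
theorem half_turn_cases (hp : EqSign p⁻¹ p) :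
    (p⁻¹ = p ∧ p * p = 1 ∧ ∀ x, p * (p * x) = x) ∨
      (p⁻¹ = -p ∧ p * p = -1 ∧ ∀ x, p * (p * x) = -x) := by
  rcases hp with h | h
  · have h1 : p * p = 1 := by nth_rw 1 [← h]; simp
    exact Or.inl ⟨h, h1, fun x => by rw [← mul_assoc, h1, one_mul]⟩
  · have h1 : p * p = -1 := by
      rw [← neg_neg (p * p), ← neg_mul, ← h]; simp
    exact Or.inr ⟨h, h1, fun x => by rw [← mul_assoc, h1, neg_one_mul]⟩

set_option linter.unusedSimpArgs false in
/-- In the group generated by half-turns `p`, `q`, `r`, a right-handed half twist of `q`, `r` is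
the conjugation by the conjugate of `p * q * r`, up to sign and up to a power of `p * q * r`. -/
theorem eqSign_right_middle (hp : EqSign p⁻¹ p) (hq : EqSign q⁻¹ q) (hr : EqSign r⁻¹ r) :
    EqSign (r⁻¹ * q * r) (r * (p * q * r) * r⁻¹ * q * (p * q * r)) := by
  rcases half_turn_cases hp with ⟨h1, h2, h3⟩ | ⟨h1, h2, h3⟩ <;>
  rcases half_turn_cases hq with ⟨k1, k2, k3⟩ | ⟨k1, k2, k3⟩ <;>
  rcases half_turn_cases hr with ⟨l1, l2, l3⟩ | ⟨l1, l2, l3⟩ <;>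
  simp [EqSign, mul_assoc, h1, h2, h3, k1, k2, k3, l1, l2, l3]

set_option linter.unusedSimpArgs false in
theorem eqSign_right_left (hp : EqSign p⁻¹ p) (hq : EqSign q⁻¹ q) (hr : EqSign r⁻¹ r) :
    EqSign (q⁻¹ * p * q) (q * (p * q * r) * q⁻¹ * p * (p * q * r)) := by
  rcases half_turn_cases hp with ⟨h1, h2, h3⟩ | ⟨h1, h2, h3⟩ <;>
  rcases half_turn_cases hq with ⟨k1, k2, k3⟩ | ⟨k1, k2, k3⟩ <;>
  rcases half_turn_cases hr with ⟨l1, l2, l3⟩ | ⟨l1, l2, l3⟩ <;>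
  simp [EqSign, mul_assoc, h1, h2, h3, k1, k2, k3, l1, l2, l3]

-- Up to sign `(p * q * r)⁻¹` is `r * q * p`, and then both occurrences cancel down to `q * r * q`.
set_option linter.unusedSimpArgs false in
theorem eqSign_left_middle (hp : EqSign p⁻¹ p) (hq : EqSign q⁻¹ q) (hr : EqSign r⁻¹ r) :
    EqSign (q * r * q⁻¹) (q * (p * q * r)⁻¹ * q⁻¹ * r * (p * q * r)⁻¹) := by
  rcases half_turn_cases hp with ⟨h1, h2, h3⟩ | ⟨h1, h2, h3⟩ <;>
  rcases half_turn_cases hq with ⟨k1, k2, k3⟩ | ⟨k1, k2, k3⟩ <;>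
  rcases half_turn_cases hr with ⟨l1, l2, l3⟩ | ⟨l1, l2, l3⟩ <;>
  simp [EqSign, mul_assoc, h1, h2, h3, k1, k2, k3, l1, l2, l3]

set_option linter.unusedSimpArgs false in
theorem eqSign_left_left (hp : EqSign p⁻¹ p) (hq : EqSign q⁻¹ q) (hr : EqSign r⁻¹ r) :
    EqSign (p * q * p⁻¹) (p * (p * q * r)⁻¹ * p⁻¹ * q * (p * q * r)⁻¹) := by
  rcases half_turn_cases hp with ⟨h1, h2, h3⟩ | ⟨h1, h2, h3⟩ <;>
  rcases half_turn_cases hq with ⟨k1, k2, k3⟩ | ⟨k1, k2, k3⟩ <;>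
  rcases half_turn_cases hr with ⟨l1, l2, l3⟩ | ⟨l1, l2, l3⟩ <;>
  simp [EqSign, mul_assoc, h1, h2, h3, k1, k2, k3, l1, l2, l3]

theorem eqSign_inv_conj (hp : EqSign p⁻¹ p) : EqSign (q * p * q⁻¹)⁻¹ (q * p * q⁻¹) := by
  rcases hp with h | h <;> simp [EqSign, mul_assoc, h]

end Group

/-- The element by which a crossing conjugates the half-turn of the under-strand. -/
noncomputable def conjugator (c : Crossing) (P : Fin 4 → Lin) : Lin :=
  if c.rightHanded then (P c.overPos)⁻¹ else P c.overPos

/-- The half-turns below a crossing, from those above it. -/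
noncomputable def twist (c : Crossing) (P : Fin 4 → Lin) : Fin 4 → Lin :=
  Function.update (Function.update P c.underPos (P c.overPos)) c.overPos
    (conjugator c P * P c.underPos * (conjugator c P)⁻¹)

/-- A system of half-turns `P` for the directions `dir` and the vectors `v` at the four
positions: `P p` carries the vector `b` at the position `3` to `v p`, up to sign. -/
structure IsTurnSystem (dir : Fin 4 → ℤˣ) (v : Fin 4 → Vec) (P : Fin 4 → Lin) : Prop where
  three : P 3 = 1
  mem (p : Fin 4) : P p ∈ symmetricLin
  inv (p : Fin 4) : EqSign (P p)⁻¹ (P p)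
  det (p : Fin 4) : (P p : Matrix (Fin 2) (Fin 2) ℤ[X]).det = signPoly (dir p * dir 3)
  vec (p : Fin 4) : EqSign (v p) (act (P p) (0, 1))
  prod : EqSign (P 0 * P 1 * P 2) (transB (dir 3))

theorem overPos_ne_underPos (c : Crossing) : c.overPos ≠ c.underPos := by
  rcases c with ⟨_ | _, _ | _⟩ <;>
    simp [Crossing.overPos, Crossing.underPos, Crossing.left, Crossing.right]

theorem perm_eq_swap (c : Crossing) : c.perm = Equiv.swap c.overPos c.underPos := by
  rcases c with ⟨_ | _, _ | _⟩ <;>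
    simp [Crossing.perm, Crossing.overPos, Crossing.underPos, Equiv.swap_comm]

theorem det_conj (c M : Lin) : ((c * M * c⁻¹ : Lin) : Matrix (Fin 2) (Fin 2) ℤ[X]).det =
    (M : Matrix (Fin 2) (Fin 2) ℤ[X]).det := by
  simp only [Units.val_mul]
  exact Matrix.det_units_conj c _

/-- `twist` conjugates the half-turns along the strands. -/
theorem twist_apply (c : Crossing) (P : Fin 4 → Lin) (p : Fin 4) :
    twist c P p = (if p = c.overPos then conjugator c P else 1) * P (c.perm p) *
      (if p = c.overPos then conjugator c P else 1)⁻¹ := by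
  rw [perm_eq_swap]
  by_cases h : p = c.overPos
  · subst h; simp [twist]
  · by_cases h' : p = c.underPos
    · subst h'; simp [twist, h]
    · simp [twist, h, h', Equiv.swap_apply_of_ne_of_ne]

namespace IsTurnSystem

variable {dir : Fin 4 → ℤˣ} {v : Fin 4 → Vec} {P : Fin 4 → Lin}

theorem conjugator_mem (h : IsTurnSystem dir v P) (c : Crossing) :
    conjugator c P ∈ symmetricLin := by
  unfold conjugator; split_ifs
  · exact inv_mem (h.mem _)
  · exact h.mem _

/-- The link between conjugating half-turns and the quandle operation: the last factor fixes `b`,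
and the first three form a transvection along the vector of the over-strand. -/
theorem eqSign_conj (h : IsTurnSystem dir v P) (c : Crossing) :
    ∃ e : ℤˣ, EqSign (conjugator c P * P c.underPos * (conjugator c P)⁻¹)
      (P c.overPos * transB (c.sign * dir 3) * (P c.overPos)⁻¹ * P c.underPos * transB e) := by
  have hp := h.prod.inv
  rw [transB_inv] at hp
  rcases c with ⟨_ | _, _ | _⟩ <;>
    simp only [conjugator, Crossing.overPos, Crossing.underPos, Crossing.left, Crossing.right,
      Crossing.sign, if_true, Bool.false_eq_true, if_false, one_mul, neg_one_mul, inv_inv]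
  · exact ⟨-dir 3, (eqSign_left_left (h.inv 0) (h.inv 1) (h.inv 2)).trans
      ((((EqSign.refl _).mul hp).mul (.refl _)).mul (.refl _) |>.mul hp)⟩
  · exact ⟨dir 3, (eqSign_right_left (h.inv 0) (h.inv 1) (h.inv 2)).trans
      ((((EqSign.refl _).mul h.prod).mul (.refl _)).mul (.refl _) |>.mul h.prod)⟩
  · exact ⟨-dir 3, (eqSign_left_middle (h.inv 0) (h.inv 1) (h.inv 2)).trans
      ((((EqSign.refl _).mul hp).mul (.refl _)).mul (.refl _) |>.mul hp)⟩
  · exact ⟨dir 3, (eqSign_right_middle (h.inv 0) (h.inv 1) (h.inv 2)).trans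
      ((((EqSign.refl _).mul h.prod).mul (.refl _)).mul (.refl _) |>.mul h.prod)⟩

theorem perm_three (c : Crossing) : c.perm 3 = 3 := by
  rcases c with ⟨_ | _, _ | _⟩ <;> decide

theorem passCrossing_twist (h : IsTurnSystem dir v P) (c : Crossing) :
    IsTurnSystem (dir ∘ c.perm) (passCrossing c dir v) (twist c P) where
  three := by
    rw [twist_apply, perm_three, h.three]; simp
  mem p := by
    have hc : (if p = c.overPos then conjugator c P else 1) ∈ symmetricLin := by
      split_ifs
      · exact h.conjugator_mem c
      · exact one_mem _
    rw [twist_apply]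
    exact mul_mem (mul_mem hc (h.mem _)) (inv_mem hc)
  inv p := by
    rw [twist_apply]; exact eqSign_inv_conj (h.inv _)
  det p := by
    rw [twist_apply, det_conj, h.det, Function.comp, Function.comp, perm_three]
  vec p := by
    by_cases hp : p = c.overPos
    · subst hp
      obtain ⟨e, he⟩ := h.eqSign_conj c
      have h1 := EqSign.act he (EqSign.refl ((0, 1) : Vec))
      rw [act_mul _ (transB e), act_transB_b, act_mul _ (P c.underPos)] at h1
      -- The quandle exponent times the determinant of the over-strand's half-turn, as
      -- `act_conj_transB` requires.
      have h2 : c.sign * dir 3 = (c.sign * dir c.overPos) * (dir c.overPos * dir 3) := by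
        rw [mul_assoc, ← mul_assoc (dir _), Int.units_mul_self, one_mul]
      rw [h2, act_conj_transB _ _ _ (h.det _)] at h1
      simp only [twist, passCrossing, Function.update_self]
      exact (EqSign.trans (.quandleOp (h.vec _) (h.vec _)) h1.symm).neg_left
    · by_cases hp' : p = c.underPos
      · subst hp'
        simpa [twist, passCrossing, hp] using h.vec _
      · simpa [twist, passCrossing, hp, hp'] using h.vec _
  prod := by
    rw [Function.comp, perm_three]
    -- As in the braid action, the two factors `x * y` become `y * (y⁻¹ * x * y)` or `(x * y * x⁻¹)
    -- * x`.
    convert h.prod using 1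
    rcases c with ⟨_ | _, _ | _⟩ <;>
    simp [twist, conjugator, Crossing.overPos, Crossing.underPos, Crossing.left, Crossing.right,
      mul_assoc]

end IsTurnSystem

theorem carry_three (cs : List Crossing) : carry cs 3 = 3 := by
  induction cs with
  | nil => rfl
  | cons c cs ih => simp [carry, IsTurnSystem.perm_three, ih]

theorem perm_symm (c : Crossing) : c.perm.symm = c.perm := Equiv.symm_swap _ _

theorem dir_comp_carry_cons (c : Crossing) (cs : List Crossing) (dir : Fin 4 → ℤˣ) :
    dir ∘ (carry (c :: cs)).symm = (dir ∘ c.perm) ∘ (carry cs).symm := by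
  ext p : 1
  simp only [carry, Function.comp, Equiv.Perm.mul_def, Equiv.symm_trans_apply, perm_symm]

/-- Half-turns are conjugated along the strands. -/
theorem IsTurnSystem.descend (cs : List Crossing) {dir : Fin 4 → ℤˣ} {v : Fin 4 → Vec}
    {P : Fin 4 → Lin} (h : IsTurnSystem dir v P) :
    ∃ Q, IsTurnSystem (dir ∘ (carry cs).symm) (descend cs dir v) Q ∧
      ∀ p, ∃ d ∈ symmetricLin, Q (carry cs p) = d * P p * d⁻¹ := by
  induction cs generalizing dir v P with
  | nil => exact ⟨P, h, fun p => ⟨1, one_mem _, by simp [carry]⟩⟩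
  | cons c cs ih =>
    obtain ⟨Q, hQ, hconj⟩ := ih (h.passCrossing_twist c)
    refine ⟨Q, by rw [dir_comp_carry_cons]; exact hQ, fun p => ?_⟩
    obtain ⟨d, hd, hd'⟩ := hconj (c.perm p)
    refine ⟨d * (if c.perm p = c.overPos then conjugator c P else 1), mul_mem hd ?_, ?_⟩
    · split_ifs
      · exact h.conjugator_mem c
      · exact one_mem _
    · have : c.perm (c.perm p) = p := by
        nth_rw 1 [← perm_symm]; simp
      rw [carry, Equiv.Perm.mul_apply, hd', twist_apply, this]
      simp only [mul_assoc, mul_inv_rev]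

/-! ### The half-turns at the top and the factorization -/

/-- A map of determinant `-s` that exchanges the lines of `a` and `b`. -/
noncomputable def exchange (s : ℤˣ) : Lin where
  val := !![0, 1; signPoly s, 0]
  inv := !![0, signPoly s; 1, 0]
  val_inv := by
    ext i j : 2; fin_cases i <;> fin_cases j <;> simp [Matrix.mul_apply, signPoly_mul_self]
  inv_val := by
    ext i j : 2; fin_cases i <;> fin_cases j <;> simp [Matrix.mul_apply, signPoly_mul_self]

/-- A reflection that negates `b`. -/
noncomputable def reflShear (s : ℤˣ) : Lin where
  val := !![1, 0; -(signPoly s * X), -1]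
  inv := !![1, 0; -(signPoly s * X), -1]
  val_inv := by ext i j : 2; fin_cases i <;> fin_cases j <;> simp [Matrix.mul_apply]
  inv_val := by ext i j : 2; fin_cases i <;> fin_cases j <;> simp [Matrix.mul_apply]

@[simp] theorem negArg_signPoly (s : ℤˣ) : negArg (signPoly s) = signPoly s := by
  simp [signPoly]

theorem exchange_mem (s : ℤˣ) : exchange s ∈ symmetricLin := by
  refine Or.inr ?_
  ext i j : 3
  rw [flip_apply]
  fin_cases i <;> fin_cases j <;> simp [exchange]

theorem reflShear_mem (s : ℤˣ) : reflShear s ∈ symmetricLin := by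
  refine Or.inl ?_
  ext i j : 3
  rw [flip_apply]
  fin_cases i <;> fin_cases j <;> simp [reflShear]

theorem exchange_inv (s : ℤˣ) : EqSign (exchange s)⁻¹ (exchange s) := by
  rcases Int.units_eq_one_or s with rfl | rfl
  · refine Or.inl ?_
    ext i j : 3; fin_cases i <;> fin_cases j <;> simp [exchange]
  · refine Or.inr ?_
    ext i j : 3; fin_cases i <;> fin_cases j <;> simp [exchange]

theorem reflShear_inv (s : ℤˣ) : EqSign (reflShear s)⁻¹ (reflShear s) := Or.inl rfl

/-- The half-turns at the top. -/
noncomputable def topTurn (dir : Fin 4 → ℤˣ) : Fin 4 → Lin :=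
  ![exchange (-(dir 0 * dir 3)), exchange (-(dir 1 * dir 3)), reflShear (dir 3), 1]

/-- The vectors at the top. -/
noncomputable def topVec : Fin 4 → Vec := ![(1, 0), (1, 0), (0, 1), (0, 1)]

/-- The signs in `topTurn` are dictated by the determinants. The product of the first two half-turns
is `±diag(1, -1)`, so the shear in the third one makes the total product `±transB (dir 3)`. -/
theorem isTurnSystem_top {dir : Fin 4 → ℤˣ} (h : ∀ p, dir (topCap p) = -dir p) :
    IsTurnSystem dir topVec (topTurn dir) where
  three := rfl
  mem p := by
    fin_cases p
    exacts [exchange_mem _, exchange_mem _, reflShear_mem _, one_mem _]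
  inv p := by
    fin_cases p
    exacts [exchange_inv _, exchange_inv _, reflShear_inv _, Or.inl inv_one]
  det p := by
    have h2 : dir 2 = -dir 3 := h 3
    fin_cases p <;> simp [topTurn, exchange, reflShear, h2, Int.units_mul_self, signPoly_mul]
  vec p := by
    fin_cases p
    · exact Or.inl (by ext1 <;> simp [topTurn, topVec, exchange, act])
    · exact Or.inl (by ext1 <;> simp [topTurn, topVec, exchange, act])
    · exact Or.inr (by ext1 <;> simp [topTurn, topVec, reflShear, act])
    · exact Or.inl (by ext1 <;> simp [topTurn, topVec, act])
  prod := by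
    have h1 : dir 1 = -dir 0 := h 0
    rcases Int.units_eq_one_or (dir 0) with h0 | h0 <;>
    rcases Int.units_eq_one_or (dir 3) with h3 | h3 <;>
    simp only [topTurn, h1, h0, h3]
    on_goal 1 => refine Or.inl ?_
    on_goal 2 => refine Or.inr ?_
    on_goal 3 => refine Or.inr ?_
    on_goal 4 => refine Or.inl ?_
    all_goals
      ext i j : 3
      fin_cases i <;> fin_cases j <;> simp [exchange, reflShear, transB, Matrix.mul_apply]

theorem bottomCap_mul_self (ns : List ℤ) (p : Fin 4) : bottomCap ns (bottomCap ns p) = p := by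
  unfold bottomCap; split_ifs <;> revert p <;> decide

theorem bottomCapAtTop_apply (ns : List ℤ) (p : Fin 4) : bottomCapAtTop ns p =
    (carry (crossings ns)).symm (bottomCap ns (carry (crossings ns) p)) := rfl

theorem topCap_mul_self (p : Fin 4) : topCap (topCap p) = p := by
  revert p; decide

/-- In a diagram with one component the strand that is joined to the last strand at the bottom
is not joined to it at the top. -/
theorem bottomCapAtTop_three_ne {ns : List ℤ} (h : IsKnot ns) : bottomCapAtTop ns 3 ≠ topCap 3 := by
  intro h3
  have hinv : ∀ p, bottomCapAtTop ns (bottomCapAtTop ns p) = p := fun p => by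
    simp [bottomCapAtTop_apply, bottomCap_mul_self]
  -- Otherwise the last strand and its neighbour would form a component by themselves.
  have key : ∀ x ∈ Subgroup.closure {topCap, bottomCapAtTop ns},
      ∀ p : Fin 4, (p = 3 ∨ p = topCap 3) → (x p = 3 ∨ x p = topCap 3) := by
    intro x hx
    induction hx using Subgroup.closure_induction_left with
    | one => exact fun p hp => hp
    | mul_left y hy z hz ih =>
      intro p hp
      rcases hy with rfl | rfl <;> rcases ih p hp with h | h <;>
        simp [Equiv.Perm.mul_apply, h, topCap_mul_self, h3]
      rw [← h3, hinv]; simp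
    | inv_mul_cancel y hy z hz ih =>
      intro p hp
      have h1 : y⁻¹ = y := by
        rw [inv_eq_iff_mul_eq_one]
        rcases hy with rfl | rfl
        · exact Equiv.ext topCap_mul_self
        · exact Equiv.ext hinv
      rw [h1]
      rcases hy with rfl | rfl <;> rcases ih p hp with h | h <;>
        simp [Equiv.Perm.mul_apply, h, topCap_mul_self, h3]
      rw [← h3, hinv]; simp
  obtain ⟨⟨x, hx⟩, hx'⟩ := h.exists_smul_eq (3 : Fin 4) 0
  have h0 : x 3 = 0 := hx'
  have := key x hx 3 (Or.inl rfl)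
  rw [h0] at this
  revert this; decide

/-- The rep-polynomial comes from the strands that meet at the bottom of the last strand. -/
theorem rawRepPoly_eq (ns : List ℤ) (o : Orientation ns) :
    rawRepPoly ns o = form (bottomVec ns o (bottomCap ns 3)) (bottomVec ns o 3) := by
  unfold rawRepPoly bottomCap; split_ifs <;> rfl

/-- The half-turns at the bottom. -/
theorem exists_bottom_turns (ns : List ℤ) (hK : IsKnot ns) (o : Orientation ns) :
    ∃ Q, IsTurnSystem (o.dir ∘ (carry (crossings ns)).symm) (bottomVec ns o) Q ∧
      ∃ d ∈ symmetricLin, Q (bottomCap ns 3) = d * exchange 1 * d⁻¹ := by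
  obtain ⟨Q, hQ, hconj⟩ := (isTurnSystem_top o.dir_topCap).descend (crossings ns)
  refine ⟨Q, hQ, ?_⟩
  obtain ⟨d, hd, h⟩ := hconj (bottomCapAtTop ns 3)
  refine ⟨d, hd, ?_⟩
  have h1 : carry (crossings ns) (bottomCapAtTop ns 3) = bottomCap ns 3 := by
    simp [bottomCapAtTop_apply, carry_three]
  rw [h1] at h
  rw [h]
  congr 2
  have h2 := bottomCapAtTop_three_ne hK
  have h3 := o.dir_bottomCap 3
  have h4 : o.dir 0 * o.dir 3 = -1 → topTurn o.dir 0 = exchange 1 := fun h => by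
    simp [topTurn, h]
  have h5 : o.dir 1 * o.dir 3 = -1 → topTurn o.dir 1 = exchange 1 := fun h => by
    simp [topTurn, h]
  generalize bottomCapAtTop ns 3 = j at *
  -- Positions `0` and `1` give `exchange 1`, as the strand runs opposite to the last one; `2` would
  -- be a second component, and `3` would reverse its own direction.
  fin_cases j
  · exact h4 (by have : o.dir 0 = -o.dir 3 := h3
                 rw [this, neg_mul, Int.units_mul_self])
  · exact h5 (by have : o.dir 1 = -o.dir 3 := h3
                 rw [this, neg_mul, Int.units_mul_self])
  · exact absurd rfl h2
  · have : o.dir 3 = -o.dir 3 := h3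
    rcases Int.units_eq_one_or (o.dir 3) with h | h <;> rw [h] at this <;>
      exact absurd this (by decide)

theorem EqSign.form {v v' w w' : Vec} (hv : EqSign v v') (hw : EqSign w w') :
    EqSign (form v w) (form v' w') := by
  rcases hv with rfl | rfl <;> rcases hw with rfl | rfl <;> simp [EqSign, TwoBridge.form] <;> grind

/-- The factorization of the rep-polynomial. -/
theorem exists_factorization (ns : List ℤ) (hK : IsKnot ns) (o : Orientation ns) :
    ∃ f h : ℤ[X], EqSign (rawRepPoly ns o) (X * ((h + f) * (h - f))) ∧ IsCoprime f h ∧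
      ((f.comp (-X) = f ∧ h.comp (-X) = -h) ∨ (f.comp (-X) = -f ∧ h.comp (-X) = h)) := by
  obtain ⟨Q, hQ, d, hd, hi⟩ := exists_bottom_turns ns hK o
  -- The coordinates of `d⁻¹ b`; `exchange 1` swaps them, so the form becomes a difference of
  -- squares.
  refine ⟨d⁻¹ 0 1, d⁻¹ 1 1, ?_, ?_, ?_⟩
  · have h1 := hQ.vec (bottomCap ns 3)
    have h2 := hQ.vec 3
    rw [hi, act_mul, act_mul] at h1
    rw [hQ.three, act_one] at h2
    have h3 : form (act d (act (exchange 1) (act d⁻¹ (0, 1)))) (0, 1) =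
        (d : Matrix (Fin 2) (Fin 2) ℤ[X]).det *
          (X * ((d⁻¹ 1 1 + d⁻¹ 0 1) * (d⁻¹ 1 1 - d⁻¹ 0 1))) := by
      have : (0, 1) = act d (act d⁻¹ (0, 1)) := by rw [← act_mul]; simp
      conv_lhs => rw [this]
      rw [form_act, ← this]
      congr 1
      simp [form, act, exchange]
      ring
    have h4 : EqSign (d : Matrix (Fin 2) (Fin 2) ℤ[X]).det 1 := by
      have : IsUnit (d : Matrix (Fin 2) (Fin 2) ℤ[X]).det :=
        (Matrix.isUnit_iff_isUnit_det _).1 d.isUnit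
      obtain ⟨c, hc, hc'⟩ := Polynomial.isUnit_iff.1 this
      rcases Int.isUnit_iff.1 hc with rfl | rfl
      · exact Or.inl (by rw [← hc']; simp)
      · exact Or.inr (by rw [← hc']; simp)
    rw [rawRepPoly_eq]
    refine (EqSign.form h1 h2).trans ?_
    rw [h3]
    simpa using h4.mul (EqSign.refl (X * ((d⁻¹ 1 1 + d⁻¹ 0 1) * (d⁻¹ 1 1 - d⁻¹ 0 1))))
  · have h1 : (d * d⁻¹ : Lin) 1 1 = 1 := by simp
    rw [Units.val_mul, Matrix.mul_apply, Fin.sum_univ_two] at h1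
    exact ⟨_, _, h1⟩
  · have := inv_mem hd
    rw [mem_symmetricLin] at this
    simp only [← negArg_apply]
    -- `flip` puts an extra sign on the off-diagonal entry only, hence the opposite parities.
    have h0 := flip_apply d⁻¹ 0 1
    have h1 := flip_apply d⁻¹ 1 1
    rcases this with h | h <;> rw [h] at h0 h1
    · exact Or.inr ⟨by simpa [neg_eq_iff_eq_neg] using h0.symm, by simpa using h1.symm⟩
    · exact Or.inl ⟨by simpa using h0.symm, by simpa using h1.symm⟩

/-! ### The rep-polynomial modulo two -/

open Polynomial.Chebyshev in
theorem natDegree_monic_S (R : Type*) [CommRing R] [Nontrivial R] (n : ℕ) :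
    (S R n).natDegree = n ∧ (S R n).Monic := by
  induction n using Nat.strong_induction_on with
  | _ n ih =>
    match n with
    | 0 => simp
    | 1 => simp [monic_X]
    | n + 2 =>
      obtain ⟨h1, h2⟩ := ih (n + 1) (by omega)
      obtain ⟨h3, h4⟩ := ih n (by omega)
      push_cast at h1 h2 ⊢
      rw [S_add_two]
      have h5 : (X * S R ((n : ℤ) + 1)).natDegree = n + 2 := by
        rw [monic_X.natDegree_mul h2, h1, natDegree_X]; omega
      have h6 : (X * S R ((n : ℤ) + 1)).Monic := monic_X.mul h2
      have h7 : (S R (n : ℤ)).degree < (X * S R ((n : ℤ) + 1)).degree := by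
        rw [degree_eq_natDegree h4.ne_zero, degree_eq_natDegree h6.ne_zero, h3, h5]
        exact_mod_cast (by omega : n < n + 2)
      exact ⟨by rw [natDegree_sub_eq_left_of_natDegree_lt (by omega), h5],
        h6.sub_of_left h7⟩

/-- Reduction modulo two. -/
noncomputable def modTwo : ℤ[X] →+* (ZMod 2)[X] := mapRingHom (Int.castRingHom (ZMod 2))

@[simp] theorem modTwo_X : modTwo X = X := by simp [modTwo]

open Polynomial.Chebyshev in
/-- The vectors which appear modulo two; the vectors `a` and `b` have the numbers `0` and `1`. -/
noncomputable def chain (n : ℤ) : (ZMod 2)[X] × (ZMod 2)[X] :=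
  (S (ZMod 2) (n - 2), S (ZMod 2) (n - 1))

/-- The linear map that takes each vector of `chain` to the next one. -/
noncomputable def chainStep (v : (ZMod 2)[X] × (ZMod 2)[X]) : (ZMod 2)[X] × (ZMod 2)[X] :=
  (v.2, X * v.2 - v.1)

theorem chainStep_chain (n : ℤ) : chainStep (chain n) = chain (n + 1) := by
  have h := Polynomial.Chebyshev.S_add_one (ZMod 2) (n - 1)
  ring_nf at h
  ext1 <;> simp only [chain, chainStep] <;> ring_nf
  rw [h]

theorem chainStep_injective : Function.Injective chainStep := by
  rintro ⟨a, b⟩ ⟨c, d⟩ h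
  simp only [chainStep, Prod.mk.injEq] at h
  obtain ⟨rfl, h⟩ := h
  rw [sub_right_inj] at h
  rw [h]

theorem chain_zero : chain 0 = (1, 0) := by
  ext1 <;> simp [chain, CharTwo.neg_eq]

theorem chain_one : chain 1 = (0, 1) := by
  ext1 <;> simp [chain]

/-- The quandle operation modulo two. -/
noncomputable def opTwo (v w : (ZMod 2)[X] × (ZMod 2)[X]) : (ZMod 2)[X] × (ZMod 2)[X] :=
  v + (X * (v.1 * w.2 - v.2 * w.1)) • w

/-- The quandle operation is the one of the dihedral quandle of the integers. -/
theorem opTwo_chain (m n : ℤ) : opTwo (chain m) (chain n) = chain (2 * n - m) := by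
  -- `chainStep` has determinant one, so it preserves the form; shifting reduces the claim to `n =
  -- 0`.
  have hstep : ∀ v w, opTwo (chainStep v) (chainStep w) = chainStep (opTwo v w) := fun v w => by
    ext1 <;> simp only [opTwo, chainStep, Prod.fst_add, Prod.snd_add, Prod.smul_fst, Prod.smul_snd,
      smul_eq_mul] <;> ring
  induction n using Int.induction_on generalizing m with
  | zero =>
    have h := Polynomial.Chebyshev.S_eq (ZMod 2) m
    ext1
    · simp [opTwo, chain, h, Polynomial.Chebyshev.S_neg_sub_two]; ring
    · simp [opTwo, chain, Polynomial.Chebyshev.S_neg_sub_one, CharTwo.neg_eq]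
  | succ n ih =>
    have h := hstep (chain (m - 1)) (chain n)
    rw [ih, chainStep_chain, chainStep_chain, chainStep_chain] at h
    convert h using 2 <;> ring_nf
  | pred n ih =>
    apply chainStep_injective
    rw [← hstep, chainStep_chain, chainStep_chain, chainStep_chain]
    convert ih (m + 1) using 2 <;> ring_nf

/-- The numbers below a crossing in a colouring of the diagram by integers. -/
def colorCrossing (c : Crossing) (n : Fin 4 → ℤ) : Fin 4 → ℤ :=
  Function.update (Function.update n c.underPos (n c.overPos)) c.overPos
    (2 * n c.overPos - n c.underPos)

/-- The numbers at the bottom in a colouring of the diagram by integers. -/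
def color : List Crossing → (Fin 4 → ℤ) → Fin 4 → ℤ
  | [], n => n
  | c :: cs, n => color cs (colorCrossing c n)

/-- Reduction of vectors modulo two. -/
noncomputable def redVec (v : Vec) : (ZMod 2)[X] × (ZMod 2)[X] := (modTwo v.1, modTwo v.2)

theorem redVec_quandleOp (s : ℤˣ) (v w : Vec) :
    redVec (-quandleOp s v w) = opTwo (redVec v) (redVec w) := by
  have hs : ((((s : ℤˣ) : ℤ) : (ZMod 2)[X])) = 1 := by
    rcases Int.units_eq_one_or s with rfl | rfl <;> simp [CharTwo.neg_eq]
  ext1 <;> simp [redVec, quandleOp, opTwo, form, hs, CharTwo.neg_eq, add_comm]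

theorem redVec_descend (cs : List Crossing) (dir : Fin 4 → ℤˣ) (v : Fin 4 → Vec) (n : Fin 4 → ℤ)
    (h : ∀ p, redVec (v p) = chain (n p)) (p : Fin 4) :
    redVec (descend cs dir v p) = chain (color cs n p) := by
  induction cs generalizing dir v n with
  | nil => exact h p
  | cons c cs ih =>
    refine ih _ _ _ fun q => ?_
    by_cases hq : q = c.overPos
    · subst hq
      simp [passCrossing, colorCrossing, redVec_quandleOp, h, opTwo_chain]
    · by_cases hq' : q = c.underPos
      · subst hq'; simp [passCrossing, colorCrossing, hq, h]
      · simp [passCrossing, colorCrossing, hq, hq', h]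

theorem color_append (cs cs' : List Crossing) (n : Fin 4 → ℤ) :
    color (cs ++ cs') n = color cs' (color cs n) := by
  induction cs generalizing n with
  | nil => rfl
  | cons c cs ih => exact ih _

/-- The difference of the colours that a block of half twists changes. -/
def movingDiff (mid : Bool) (n : Fin 4 → ℤ) : ℤ := if mid then n 2 - n 3 else n 2 - n 1

/-- The difference between the two twisted strands is constant through a block; with the alternating
sum zero, each half twist adds it, up to sign, to the other difference. -/
theorem color_crossing (c : Crossing) (n : Fin 4 → ℤ) (hn : n 0 - n 1 + n 2 - n 3 = 0) :
    colorCrossing c n 0 - colorCrossing c n 1 + colorCrossing c n 2 - colorCrossing c n 3 = 0 ∧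
    colorCrossing c n 3 = n 3 ∧
    movingDiff (!c.middle) (colorCrossing c n) = movingDiff (!c.middle) n ∧
    movingDiff c.middle (colorCrossing c n) = movingDiff c.middle n +
      (if c.middle = c.rightHanded then 1 else -1) * movingDiff (!c.middle) n := by
  rcases c with ⟨_ | _, _ | _⟩ <;>
    simp [colorCrossing, movingDiff, Crossing.overPos, Crossing.underPos, Crossing.left,
      Crossing.right] <;> grind

theorem color_replicate (m : ℕ) (c : Crossing) (n : Fin 4 → ℤ) (hn : n 0 - n 1 + n 2 - n 3 = 0) :
    color (List.replicate m c) n 0 - color (List.replicate m c) n 1 +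
      color (List.replicate m c) n 2 - color (List.replicate m c) n 3 = 0 ∧
    color (List.replicate m c) n 3 = n 3 ∧
    movingDiff (!c.middle) (color (List.replicate m c) n) = movingDiff (!c.middle) n ∧
    movingDiff c.middle (color (List.replicate m c) n) = movingDiff c.middle n +
      m * (if c.middle = c.rightHanded then 1 else -1) * movingDiff (!c.middle) n := by
  induction m generalizing n with
  | zero => simp [color, hn]
  | succ m ih =>
    obtain ⟨h1, h2, h3, h4⟩ := color_crossing c n hn
    obtain ⟨k1, k2, k3, k4⟩ := ih _ h1
    rw [List.replicate_succ, color]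
    refine ⟨k1, k2.trans h2, k3.trans h3, ?_⟩
    rw [k4, h4, h3]; push_cast; ring

/-- The two differences exchange roles from block to block, which is the recursion of the continued
fraction. -/
theorem color_blocks (ns : List ℤ) (mid : Bool) (n : Fin 4 → ℤ)
    (hn : n 0 - n 1 + n 2 - n 3 = 0) :
    color (blocks mid ns) n 0 - color (blocks mid ns) n 1 +
      color (blocks mid ns) n 2 - color (blocks mid ns) n 3 = 0 ∧
    color (blocks mid ns) n 3 = n 3 ∧
    movingDiff (if Odd ns.length then mid else !mid) (color (blocks mid ns) n) =
      movingDiff mid n * (slope ns).1 + movingDiff (!mid) n * (slope ns).2 := by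
  induction ns generalizing mid n with
  | nil => simp [blocks, color, slope, hn]
  | cons k ns ih =>
    rw [blocks, color_append]
    set c : Crossing := ⟨mid, if mid then decide (0 < k) else decide (k < 0)⟩ with hc
    obtain ⟨h1, h2, h3, h4⟩ := color_replicate k.natAbs c n hn
    obtain ⟨k1, k2, k3⟩ := ih (!mid) _ h1
    refine ⟨k1, k2.trans h2, ?_⟩
    have e1 : (if Odd (k :: ns).length then mid else !mid) =
        (if Odd ns.length then !mid else !!mid) := by
      by_cases h : Odd ns.length <;> simp [h, Nat.odd_add_one]
    -- The opposite handedness conventions for middle and left blocks make both contribute `+k`.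
    have e2 : (k.natAbs : ℤ) * (if c.middle = c.rightHanded then 1 else -1) = k := by
      rcases lt_trichotomy k 0 with h | rfl | h
      · have := Int.ofNat_natAbs_of_nonpos h.le
        cases mid <;> simp [hc, h, abs_of_neg, h.not_gt]
      · simp
      · cases mid <;> simp [hc, h, abs_of_pos, h.not_gt]
    have hm : c.middle = mid := rfl
    rw [hm] at h3 h4 e2
    rw [e1, k3, Bool.not_not, h3, h4, e2, slope]
    ring

theorem natAbs_color_bottom (ns : List ℤ) :
    (color (crossings ns) ![0, 0, 1, 1] (bottomCap ns 3) - 1).natAbs = alpha ns ∧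
      color (crossings ns) ![0, 0, 1, 1] 3 = 1 := by
  obtain ⟨h1, h2, h3⟩ := color_blocks ns true ![0, 0, 1, 1] (by simp)
  refine ⟨?_, h2⟩
  unfold alpha
  have h2' : color (blocks true ns) ![0, 0, 1, 1] 3 = 1 := h2
  rw [h2'] at h1
  simp only [crossings]
  generalize color (blocks true ns) ![0, 0, 1, 1] = m at *
  by_cases h : Odd ns.length
  · have hb : bottomCap ns 3 = 2 := by simp only [bottomCap, h]; decide
    simp [h, movingDiff] at h3
    rw [hb, ← h3, h2']
  · have hb : bottomCap ns 3 = 0 := by simp only [bottomCap, h]; decide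
    simp [h, movingDiff] at h3
    rw [hb]; omega

/-- The rep-polynomial is not `u`, up to sign. -/
theorem not_eqSign_rawRepPoly_X {ns : List ℤ} (hα : 1 < alpha ns) (o : Orientation ns) :
    ¬ EqSign (rawRepPoly ns o) X := by
  intro hX
  obtain ⟨h1, h2⟩ := natAbs_color_bottom ns
  have hv := redVec_descend (crossings ns) o.dir ![(1, 0), (1, 0), (0, 1), (0, 1)] ![0, 0, 1, 1]
    (by intro p; fin_cases p <;> simp [redVec, chain_zero, chain_one])
  have h3 := hv (bottomCap ns 3)
  have h4 := hv 3
  rw [h2, chain_one] at h4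
  have h5 : modTwo (rawRepPoly ns o) = X := by
    rcases hX with h | h <;> simp [h, CharTwo.neg_eq]
  generalize color (crossings ns) ![0, 0, 1, 1] (bottomCap ns 3) = m at *
  have h6 : X * Polynomial.Chebyshev.S (ZMod 2) (m - 2) = X := by
    refine Eq.trans ?_ h5
    rw [rawRepPoly_eq]
    simp only [bottomVec, form, map_mul, map_sub, modTwo_X]
    simp only [redVec, chain, Prod.mk.injEq] at h3 h4
    rw [h3.1, h3.2, h4.1, h4.2]; ring
  have h7 : Polynomial.Chebyshev.S (ZMod 2) (m - 2) = 1 := by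
    have := mul_left_cancel₀ X_ne_zero (h6.trans (mul_one _).symm)
    exact this
  -- Here `m - 1 = ±α`; the negative case is reflected by `S_{-n-2} = -S_n`. The degree `α - 1 > 0`
  -- then contradicts being constant.
  have h8 : Polynomial.Chebyshev.S (ZMod 2) ((alpha ns - 1 : ℕ) : ℤ) = 1 := by
    rcases Int.natAbs_eq (m - 1) with h | h <;> rw [h1] at h
    · rw [← h7]; congr 1; omega
    · have : m - 2 = -((alpha ns - 1 : ℕ) : ℤ) - 2 := by omega
      rw [this, Polynomial.Chebyshev.S_neg_sub_two, CharTwo.neg_eq] at h7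
      exact h7
  have h9 := (natDegree_monic_S (ZMod 2) (alpha ns - 1)).1
  rw [h8, natDegree_one] at h9
  omega

/-! ### Parabolic matrices -/

/-- The parabolic matrix that belongs to a vector of the symplectic plane. -/
noncomputable def para (v : ℂ × ℂ) : SL2C :=
  ⟨!![1 - v.1 * v.2, v.1 ^ 2; -v.2 ^ 2, 1 + v.1 * v.2], by rw [Matrix.det_fin_two_of]; ring⟩

theorem coe_para (v : ℂ × ℂ) : (para v : Matrix (Fin 2) (Fin 2) ℂ) =
    !![1 - v.1 * v.2, v.1 ^ 2; -v.2 ^ 2, 1 + v.1 * v.2] := rfl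

theorem trace_para (v : ℂ × ℂ) : (para v : Matrix (Fin 2) (Fin 2) ℂ).trace = 2 := by
  rw [coe_para, Matrix.trace_fin_two_of]; ring

theorem para_eq_of_eqSign {v w : ℂ × ℂ} (h : EqSign v w) : para v = para w := by
  rcases h with rfl | rfl
  · rfl
  · ext i j; fin_cases i <;> fin_cases j <;> simp [coe_para]

theorem det_eq_zero_of_para_eq {v w : ℂ × ℂ} (h : para v = para w) :
    v.1 * w.2 - v.2 * w.1 = 0 := by
  have h' := congrArg (fun A : SL2C => (A : Matrix (Fin 2) (Fin 2) ℂ)) h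
  simp only [coe_para] at h'
  have h00 := congrFun (congrFun h' 0) 0
  have h01 := congrFun (congrFun h' 0) 1
  have h10 := congrFun (congrFun h' 1) 0
  simp at h00 h01 h10
  rw [← sq_eq_zero_iff]
  linear_combination (w.2 ^ 2) * h01 + w.1 ^ 2 * h10 - 2 * w.1 * w.2 * h00

/-- The action of a matrix on the symplectic plane. -/
def move (A : SL2C) (v : ℂ × ℂ) : ℂ × ℂ := (A 0 0 * v.1 + A 0 1 * v.2, A 1 0 * v.1 + A 1 1 * v.2)

theorem para_move (A : SL2C) (v : ℂ × ℂ) : para (move A v) = A * para v * A⁻¹ := by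
  have hA : A 0 0 * A 1 1 - A 0 1 * A 1 0 = 1 := by
    rw [← Matrix.det_fin_two, A.det_coe]
  rw [eq_mul_inv_iff_mul_eq]
  ext i j
  fin_cases i <;> fin_cases j <;>
    simp only [Matrix.SpecialLinearGroup.coe_mul, coe_para, move, Matrix.mul_apply,
      Fin.sum_univ_two, Fin.zero_eta, Fin.mk_one, Fin.isValue, Matrix.of_apply,
      Matrix.cons_val', Matrix.cons_val_zero, Matrix.cons_val_one, Matrix.cons_val_fin_one]
  · linear_combination (-(A 0 0 * v.1 + A 0 1 * v.2) * v.2) * hA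
  · linear_combination ((A 0 0 * v.1 + A 0 1 * v.2) * v.1) * hA
  · linear_combination (-(A 1 0 * v.1 + A 1 1 * v.2) * v.2) * hA
  · linear_combination ((A 1 0 * v.1 + A 1 1 * v.2) * v.1) * hA

/-- As `A - 1` has trace and determinant zero, `-A 0 1 * A 1 0 = (1 - A 0 0)²`; the coordinates are
square roots of `A 0 1` and `-A 1 0` with matching signs. -/
theorem exists_eq_para (A : SL2C) (hA : (A : Matrix (Fin 2) (Fin 2) ℂ).trace = 2) :
    ∃ v, A = para v := by
  have hdet : A 0 0 * A 1 1 - A 0 1 * A 1 0 = 1 := by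
    rw [← Matrix.det_fin_two, A.det_coe]
  rw [Matrix.trace_fin_two] at hA
  obtain ⟨x, hx⟩ := IsAlgClosed.exists_pow_nat_eq (A 0 1) (n := 2) (by norm_num)
  obtain ⟨y, hy⟩ := IsAlgClosed.exists_pow_nat_eq (-A 1 0) (n := 2) (by norm_num)
  have hm : (x * y) ^ 2 = (1 - A 0 0) ^ 2 := by
    rw [mul_pow, hx, hy]; linear_combination hdet - A 0 0 * hA
  obtain ⟨z, hz, hxz⟩ : ∃ z, z ^ 2 = -A 1 0 ∧ x * z = 1 - A 0 0 := by
    rcases sq_eq_sq_iff_eq_or_eq_neg.1 hm with h | h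
    · exact ⟨y, hy, h⟩
    · exact ⟨-y, by rw [neg_sq, hy], by rw [mul_neg, h, neg_neg]⟩
  refine ⟨(x, z), ?_⟩
  ext i j
  fin_cases i <;> fin_cases j <;> simp [coe_para, hx, hz, hxz]
  linear_combination hA

theorem para_comm {v w : ℂ × ℂ} (h : v.1 * w.2 - v.2 * w.1 = 0) :
    para v * para w = para w * para v := by
  ext i j
  fin_cases i <;> fin_cases j <;>
    simp only [Matrix.SpecialLinearGroup.coe_mul, coe_para, Matrix.mul_apply,
      Fin.sum_univ_two, Fin.zero_eta, Fin.mk_one, Fin.isValue, Matrix.of_apply,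
      Matrix.cons_val', Matrix.cons_val_zero, Matrix.cons_val_one, Matrix.cons_val_fin_one]
  · linear_combination (-(v.1 * w.2 + v.2 * w.1)) * h
  · linear_combination (2 * v.1 * w.1) * h
  · linear_combination (-2 * v.2 * w.2) * h
  · linear_combination (v.1 * w.2 + v.2 * w.1) * h

/-- Two parabolic matrices that do not commute are conjugate to a standard pair. -/
theorem exists_conj_standard {A B : SL2C} (hA : (A : Matrix (Fin 2) (Fin 2) ℂ).trace = 2)
    (hB : (B : Matrix (Fin 2) (Fin 2) ℂ).trace = 2) (hAB : A * B ≠ B * A) :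
    ∃ (C : SL2C) (r : ℂ), r ≠ 0 ∧ C * A * C⁻¹ = para (1, 0) ∧ C * B * C⁻¹ = para (0, r) := by
  obtain ⟨v, rfl⟩ := exists_eq_para A hA
  obtain ⟨w, rfl⟩ := exists_eq_para B hB
  have hr : v.1 * w.2 - v.2 * w.1 ≠ 0 := fun h => hAB (para_comm h)
  -- The inverse of the matrix with columns `v` and `w / r`, where `r` is the determinant of `v, w`.
  obtain ⟨C, hC⟩ : ∃ C : SL2C, (C : Matrix (Fin 2) (Fin 2) ℂ) =
      !![w.2 / (v.1 * w.2 - v.2 * w.1), -w.1 / (v.1 * w.2 - v.2 * w.1); -v.2, v.1] :=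
    ⟨⟨_, by rw [Matrix.det_fin_two_of, ← div_self hr]; ring⟩, rfl⟩
  refine ⟨C, v.1 * w.2 - v.2 * w.1, hr, ?_, ?_⟩
  · rw [← para_move]
    congr 1
    ext1 <;> simp [move, hC]
    · linear_combination div_self hr
    · ring
  · rw [← para_move]
    congr 1
    ext1 <;> simp [move, hC] <;> field_simp <;> ring

/-! ### The evaluation of the vectors at a complex number -/

/-- The coordinates of a vector, evaluated at `u = r`. -/
noncomputable def evalCoord (r : ℂ) (v : Vec) : ℂ × ℂ := (aeval r v.1, aeval r v.2)

/-- The vector of the symplectic plane with `a = (1, 0)` and `b = (0, r)`. -/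
noncomputable def evalVec (r : ℂ) (v : Vec) : ℂ × ℂ := (aeval r v.1, r * aeval r v.2)

theorem evalVec_eqSign {r : ℂ} {v w : Vec} (h : EqSign (evalCoord r v) (evalCoord r w)) :
    EqSign (evalVec r v) (evalVec r w) := by
  simp only [EqSign, evalCoord, evalVec, Prod.ext_iff, Prod.fst_neg, Prod.snd_neg] at h ⊢
  rcases h with ⟨h1, h2⟩ | ⟨h1, h2⟩
  · exact Or.inl ⟨h1, by rw [h2]⟩
  · exact Or.inr ⟨h1, by rw [h2, mul_neg]⟩

theorem evalCoord_neg (r : ℂ) (v : Vec) : evalCoord r (-v) = -evalCoord r v := by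
  ext1 <;> simp [evalCoord]

theorem EqSign.evalCoord {v w : Vec} (r : ℂ) (h : EqSign v w) :
    EqSign (evalCoord r v) (evalCoord r w) := by
  rcases h with rfl | rfl
  · exact .refl _
  · exact Or.inr (evalCoord_neg r w)

theorem evalCoord_act {r : ℂ} {v w : Vec} (M : Lin)
    (h : EqSign (evalCoord r v) (evalCoord r w)) :
    EqSign (evalCoord r (act M v)) (evalCoord r (act M w)) := by
  simp only [EqSign, TwoBridge.evalCoord, act, Prod.ext_iff, Prod.fst_neg, Prod.snd_neg, map_add,
    map_mul] at h ⊢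
  rcases h with ⟨h1, h2⟩ | ⟨h1, h2⟩
  · exact Or.inl ⟨by rw [h1, h2], by rw [h1, h2]⟩
  · exact Or.inr ⟨by rw [h1, h2]; ring, by rw [h1, h2]; ring⟩

theorem aeval_form (r : ℂ) (v w : Vec) : aeval r (form v w) =
    (evalVec r v).1 * (evalVec r w).2 - (evalVec r v).2 * (evalVec r w).1 := by
  simp [form, evalVec]; ring

/-- `para w` is the transvection `x ↦ x - ⟨x, w⟩ w`, so its power `-s` acts as the quandle operation
with exponent `s`; `para` does not see the sign. -/
theorem para_evalVec_quandleOp (r : ℂ) (s : ℤˣ) (v w : Vec) :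
    para (evalVec r (-quandleOp s v w)) =
      para (evalVec r w) ^ (-(s : ℤ)) * para (evalVec r v) * para (evalVec r w) ^ (s : ℤ) := by
  have h : para (evalVec r (-quandleOp s v w)) =
      para (move (para (evalVec r w) ^ (-(s : ℤ))) (evalVec r v)) := by
    apply para_eq_of_eqSign
    right
    rcases Int.units_eq_one_or s with rfl | rfl <;>
      ext1 <;> simp [move, quandleOp, form, evalVec, coe_para, Matrix.SpecialLinearGroup.coe_inv,
        Matrix.adjugate_fin_two_of] <;> ring
  rw [h, para_move, zpow_neg, inv_inv]

/-! ### The arcs in the knot group -/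

section Arcs

variable (ns : List ℤ) (o : Orientation ns)

theorem arc_eq_of_isRelator {e : Piece ns} {w : FreeGroup (Piece ns)}
    (h : IsRelator ns o (FreeGroup.of e * w⁻¹)) : arc ns o e = PresentedGroup.mk _ w :=
  PresentedGroup.mk_eq_mk_of_mul_inv_mem h

theorem arc_top (p : Fin 4) : arc ns o (0, topCap p) = arc ns o (0, p) :=
  arc_eq_of_isRelator ns o (.top p)

theorem arc_bottom (p : Fin 4) :
    arc ns o (Fin.last _, bottomCap ns p) = arc ns o (Fin.last _, p) :=
  arc_eq_of_isRelator ns o (.bottom p)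

theorem arc_straight (t : Fin (numCrossings ns)) (p : Fin 4)
    (h₁ : p ≠ ((crossings ns).get t).overPos) (h₂ : p ≠ ((crossings ns).get t).underPos) :
    arc ns o (t.succ, p) = arc ns o (t.castSucc, p) := by
  refine arc_eq_of_isRelator ns o (.straight t p ?_ ?_) <;>
    rcases hc : (crossings ns).get t with ⟨_ | _, _ | _⟩ <;>
    simp_all [Crossing.overPos, Crossing.underPos, Crossing.left, Crossing.right]

theorem arc_over (t : Fin (numCrossings ns)) :
    arc ns o (t.succ, ((crossings ns).get t).underPos) =
      arc ns o (t.castSucc, ((crossings ns).get t).overPos) :=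
  arc_eq_of_isRelator ns o (.over t)

theorem arc_under (t : Fin (numCrossings ns)) (s : ℤˣ)
    (hs : s = ((crossings ns).get t).sign *
      pieceDir ns o (t.castSucc, ((crossings ns).get t).overPos)) :
    arc ns o (t.succ, ((crossings ns).get t).overPos) =
      arc ns o (t.castSucc, ((crossings ns).get t).overPos) ^ (-(s : ℤ)) *
        arc ns o (t.castSucc, ((crossings ns).get t).underPos) *
        arc ns o (t.castSucc, ((crossings ns).get t).overPos) ^ (s : ℤ) := by
  rw [arc_eq_of_isRelator ns o (.under t s hs), map_mul, map_mul, map_zpow, map_zpow]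
  rfl

/-- An induction along the diagram, from the top to the bottom. -/
theorem piece_induction {C : Piece ns → Prop} (left : C (0, 0)) (right : C (0, 2))
    (top : ∀ p, C (0, p) → C (0, topCap p))
    (straight : ∀ (t : Fin (numCrossings ns)) (p : Fin 4),
      p ≠ ((crossings ns).get t).overPos → p ≠ ((crossings ns).get t).underPos →
      C (t.castSucc, p) → C (t.succ, p))
    (overStrand : ∀ t : Fin (numCrossings ns), C (t.castSucc, ((crossings ns).get t).overPos) →
      C (t.succ, ((crossings ns).get t).underPos))
    (underStrand : ∀ t : Fin (numCrossings ns), C (t.castSucc, ((crossings ns).get t).overPos) →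
      C (t.castSucc, ((crossings ns).get t).underPos) →
      C (t.succ, ((crossings ns).get t).overPos))
    (e : Piece ns) : C e := by
  obtain ⟨t, p⟩ := e
  induction t using Fin.induction generalizing p with
  | zero =>
    fin_cases p
    exacts [left, top 0 left, right, top 2 right]
  | succ t ih =>
    by_cases h : p = ((crossings ns).get t).overPos
    · rw [h]; exact underStrand t (ih _) (ih _)
    · by_cases h' : p = ((crossings ns).get t).underPos
      · rw [h']; exact overStrand t (ih _)
      · exact straight t p h h' (ih _)

/-- The knot group is generated by the meridians of the two bridges. -/
theorem closure_bridges :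
    Subgroup.closure {arc ns o (0, 0), arc ns o (0, 2)} = ⊤ := by
  rw [eq_top_iff, ← PresentedGroup.closure_range_of, Subgroup.closure_le]
  rintro _ ⟨e, rfl⟩
  change arc ns o e ∈ Subgroup.closure _
  induction e using piece_induction with
  | left => exact Subgroup.subset_closure (by simp)
  | right => exact Subgroup.subset_closure (by simp)
  | top p h => rwa [arc_top]
  | straight t p h₁ h₂ h => rwa [arc_straight ns o t p h₁ h₂]
  | overStrand t h => rwa [arc_over]
  | underStrand t h h' =>
    rw [arc_under ns o t _ rfl]
    exact mul_mem (mul_mem (zpow_mem h _) h') (zpow_mem h _)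

theorem hom_ext {G : Type*} [Group G] {ρ σ : KnotGroup ns o →* G}
    (h₁ : ρ (arc ns o (0, 0)) = σ (arc ns o (0, 0)))
    (h₂ : ρ (arc ns o (0, 2)) = σ (arc ns o (0, 2))) : ρ = σ := by
  refine MonoidHom.eq_of_eqOn_dense (closure_bridges ns o) ?_
  rintro _ (rfl | rfl)
  exacts [h₁, h₂]

theorem bridges_not_commute {ρ : KnotGroup ns o →* SL2C} (h : IsNonabelian ns o ρ) :
    ρ (arc ns o (0, 0)) * ρ (arc ns o (0, 2)) ≠ ρ (arc ns o (0, 2)) * ρ (arc ns o (0, 0)) := by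
  intro hc
  have key : ∀ {z : SL2C}, Commute z (ρ (arc ns o (0, 0))) → Commute z (ρ (arc ns o (0, 2))) →
      ∀ x, Commute z (ρ x) := by
    intro z h₁ h₂ x
    have hx : x ∈ Subgroup.closure {arc ns o (0, 0), arc ns o (0, 2)} := by
      rw [closure_bridges]; trivial
    induction hx using Subgroup.closure_induction with
    | mem x hx => rcases hx with rfl | rfl <;> assumption
    | one => rw [map_one]; exact Commute.one_right _
    | mul x y _ _ hx hy => rw [map_mul]; exact hx.mul_right hy
    | inv x _ hx => rw [map_inv]; exact hx.inv_right
  obtain ⟨x, y, hxy⟩ := h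
  exact hxy (key (key (Commute.refl _) hc x).symm (key hc.symm (Commute.refl _) x).symm y)

/-! ### The vectors of the pieces -/

/-- The vector of a piece of the diagram. -/
noncomputable def pieceVec (e : Piece ns) : Vec :=
  descend ((crossings ns).take e.1) o.dir topVec e.2

theorem descend_append (cs : List Crossing) (c : Crossing) (dir : Fin 4 → ℤˣ)
    (v : Fin 4 → Vec) : descend (cs ++ [c]) dir v =
      passCrossing c (dir ∘ (carry cs).symm) (descend cs dir v) := by
  induction cs generalizing dir v with
  | nil => rfl
  | cons c' cs ih => rw [dir_comp_carry_cons]; exact ih _ _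

theorem pieceVec_succ (t : Fin (numCrossings ns)) (p : Fin 4) : pieceVec ns o (t.succ, p) =
    passCrossing ((crossings ns).get t) (fun q => pieceDir ns o (t.castSucc, q))
      (fun q => pieceVec ns o (t.castSucc, q)) p := by
  simp only [pieceVec, Fin.val_succ]
  rw [List.take_succ_eq_append_getElem t.2, descend_append]
  rfl

theorem pieceVec_zero (p : Fin 4) : pieceVec ns o (0, p) = topVec p := rfl

theorem pieceVec_last (p : Fin 4) : pieceVec ns o (Fin.last _, p) = bottomVec ns o p := by
  simp only [pieceVec, Fin.val_last, List.take_length]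
  rfl

variable {ns o}

theorem pieceVec_straight (t : Fin (numCrossings ns)) (p : Fin 4)
    (h₁ : p ≠ ((crossings ns).get t).overPos) (h₂ : p ≠ ((crossings ns).get t).underPos) :
    pieceVec ns o (t.succ, p) = pieceVec ns o (t.castSucc, p) := by
  rw [pieceVec_succ, passCrossing, Function.update_of_ne h₁, Function.update_of_ne h₂]

theorem pieceVec_over (t : Fin (numCrossings ns)) :
    pieceVec ns o (t.succ, ((crossings ns).get t).underPos) =
      pieceVec ns o (t.castSucc, ((crossings ns).get t).overPos) := by
  rw [pieceVec_succ, passCrossing, Function.update_of_ne (overPos_ne_underPos _).symm,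
    Function.update_self]

theorem para_pieceVec_under (r : ℂ) (t : Fin (numCrossings ns)) (s : ℤˣ)
    (hs : s = ((crossings ns).get t).sign *
      pieceDir ns o (t.castSucc, ((crossings ns).get t).overPos)) :
    para (evalVec r (pieceVec ns o (t.succ, ((crossings ns).get t).overPos))) =
      para (evalVec r (pieceVec ns o (t.castSucc, ((crossings ns).get t).overPos))) ^ (-(s : ℤ)) *
        para (evalVec r (pieceVec ns o (t.castSucc, ((crossings ns).get t).underPos))) *
        para (evalVec r (pieceVec ns o (t.castSucc, ((crossings ns).get t).overPos))) ^
          (s : ℤ) := by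
  rw [pieceVec_succ, passCrossing, Function.update_self, para_evalVec_quandleOp, hs]

/-- The standard images of the two bridges determine the images of all arcs. -/
theorem map_arc_eq_para {ρ : KnotGroup ns o →* SL2C} {r : ℂ}
    (h₁ : ρ (arc ns o (0, 0)) = para (1, 0)) (h₂ : ρ (arc ns o (0, 2)) = para (0, r))
    (e : Piece ns) : ρ (arc ns o e) = para (evalVec r (pieceVec ns o e)) := by
  induction e using piece_induction with
  | left => rw [h₁]; simp [pieceVec_zero, topVec, evalVec]
  | right => rw [h₂]; simp [pieceVec_zero, topVec, evalVec]
  | top p h =>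
    rw [arc_top, h, pieceVec_zero, pieceVec_zero]
    fin_cases p <;> rfl
  | straight t p h₁ h₂ h => rwa [arc_straight ns o t p h₁ h₂, pieceVec_straight t p h₁ h₂]
  | overStrand t h => rwa [arc_over, pieceVec_over]
  | underStrand t h h' =>
    rw [arc_under ns o t _ rfl, para_pieceVec_under r t _ rfl, map_mul, map_mul, map_zpow,
      map_zpow, h, h']

/-- The rep-polynomial vanishes at the parameters of the representations. -/
theorem aeval_rawRepPoly_eq_zero {ρ : KnotGroup ns o →* SL2C} {r : ℂ}
    (h₁ : ρ (arc ns o (0, 0)) = para (1, 0)) (h₂ : ρ (arc ns o (0, 2)) = para (0, r)) :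
    aeval r (rawRepPoly ns o) = 0 := by
  have h := congrArg ρ (arc_bottom ns o 3)
  rw [map_arc_eq_para h₁ h₂, map_arc_eq_para h₁ h₂, pieceVec_last, pieceVec_last] at h
  rw [rawRepPoly_eq, aeval_form]
  exact det_eq_zero_of_para_eq h

/-- At a non-zero root of the rep-polynomial the vectors in the bottom caps fit together. -/
theorem para_bottomVec (hK : IsKnot ns) {r : ℂ} (hr : r ≠ 0) (h : aeval r (rawRepPoly ns o) = 0)
    (p : Fin 4) :
    para (evalVec r (bottomVec ns o (bottomCap ns p))) = para (evalVec r (bottomVec ns o p)) := by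
  obtain ⟨Q, hQ, d, -, hd⟩ := exists_bottom_turns ns hK o
  -- Vanishing of the form at `r` only makes the two vectors proportional; the involution makes the
  -- factor `±1`.
  have hsq : Q (bottomCap ns 3) * Q (bottomCap ns 3) = 1 := by
    have : exchange 1 * exchange 1 = 1 := by
      ext i j : 3; fin_cases i <;> fin_cases j <;> simp [exchange, Matrix.mul_apply]
    have h2 : d * exchange 1 * d⁻¹ * (d * exchange 1 * d⁻¹) =
        d * (exchange 1 * exchange 1) * d⁻¹ := by simp [mul_assoc]
    rw [hd, h2, this]; simp
  have hi : EqSign (evalCoord r (act (Q (bottomCap ns 3)) (0, 1))) (evalCoord r (0, 1)) := by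
    have h1 := ((hQ.vec (bottomCap ns 3)).form (hQ.vec 3))
    rw [← rawRepPoly_eq, hQ.three, act_one] at h1
    have h2 : aeval r (form (act (Q (bottomCap ns 3)) (0, 1)) (0, 1)) = 0 := by
      rcases h1 with h1 | h1 <;> rw [h1] at h <;> simpa using h
    have h3 : aeval r (Q (bottomCap ns 3) 0 1) = 0 := by
      simpa [form, act, hr] using h2
    have h4 : aeval r (Q (bottomCap ns 3) 1 1) * aeval r (Q (bottomCap ns 3) 1 1) = 1 := by
      have := congrArg (fun M : Lin => aeval r (M 1 1)) hsq
      simpa only [Units.val_mul, Matrix.mul_apply, Fin.sum_univ_two, map_add, map_mul, h3,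
        mul_zero, zero_add, Units.val_one, Matrix.one_apply_eq, map_one] using this
    rcases mul_self_eq_one_iff.1 h4 with h4 | h4
    · exact Or.inl (by simp [evalCoord, act, h3, h4])
    · exact Or.inr (by simp [evalCoord, act, h3, h4])
  have hvec : ∀ j k, EqSign (evalCoord r (act (Q j) (0, 1))) (evalCoord r (act (Q k) (0, 1))) →
      para (evalVec r (bottomVec ns o j)) = para (evalVec r (bottomVec ns o k)) := fun j k hjk =>
    para_eq_of_eqSign (evalVec_eqSign
      ((((hQ.vec j).evalCoord r).trans hjk).trans ((hQ.vec k).evalCoord r).symm))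
  have hi' : para (evalVec r (bottomVec ns o (bottomCap ns 3))) =
      para (evalVec r (bottomVec ns o 3)) := hvec _ _ (by rw [hQ.three, act_one]; exact hi)
  have hT := hQ.prod
  set T := transB ((o.dir ∘ (carry (crossings ns)).symm) 3)
  have hTb : act T (0, 1) = (0, 1) := act_transB_b _
  by_cases hodd : Odd ns.length
  · have hb : bottomCap ns = Equiv.swap 0 1 * Equiv.swap 2 3 := if_pos hodd
    have e3 : bottomCap ns 3 = 2 := by rw [hb]; decide
    have e2 : bottomCap ns 2 = 3 := by rw [hb]; decide
    have e1 : bottomCap ns 1 = 0 := by rw [hb]; decide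
    have e0 : bottomCap ns 0 = 1 := by rw [hb]; decide
    rw [e3] at hi hi' hsq
    have h10 : para (evalVec r (bottomVec ns o 1)) = para (evalVec r (bottomVec ns o 0)) := by
      apply hvec
      -- The product relation closes the other cap: at `r`, both `Q 2` and `T` keep `b` up to sign.
      have h1 : EqSign (Q 1) (Q 0 * (T * Q 2)) := by
        have := ((hQ.inv 0).mul (hT.mul (.refl (Q 2))))
        simpa [mul_assoc, hsq] using this
      have h2 := (EqSign.act h1 (.refl (0, 1))).evalCoord r
      rw [act_mul, act_mul] at h2
      have h3 := evalCoord_act (Q 0) (evalCoord_act T hi)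
      rw [hTb] at h3
      exact h2.trans h3
    fin_cases p
    · exact (congrArg _ (congrArg _ (congrArg _ e0))).trans h10
    · exact (congrArg _ (congrArg _ (congrArg _ e1))).trans h10.symm
    · exact (congrArg _ (congrArg _ (congrArg _ e2))).trans hi'.symm
    · exact (congrArg _ (congrArg _ (congrArg _ e3))).trans hi'
  · have hb : bottomCap ns = Equiv.swap 0 3 * Equiv.swap 1 2 := if_neg hodd
    have e3 : bottomCap ns 3 = 0 := by rw [hb]; decide
    have e2 : bottomCap ns 2 = 1 := by rw [hb]; decide
    have e1 : bottomCap ns 1 = 2 := by rw [hb]; decide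
    have e0 : bottomCap ns 0 = 3 := by rw [hb]; decide
    rw [e3] at hi hi' hsq
    have h21 : para (evalVec r (bottomVec ns o 2)) = para (evalVec r (bottomVec ns o 1)) := by
      apply hvec
      -- Likewise, now with `T` and `Q 0` keeping `b` up to sign at `r`.
      have h1 : EqSign (Q 2) (Q 1 * (Q 0 * T)) := by
        have := ((hQ.inv 1).mul ((EqSign.refl (Q 0)).mul hT))
        rw [← mul_assoc (Q 0), ← mul_assoc (Q 0), hsq] at this
        simpa using this
      have h2 := (EqSign.act h1 (.refl (0, 1))).evalCoord r
      rw [act_mul, act_mul, hTb] at h2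
      exact h2.trans (evalCoord_act (Q 1) hi)
    fin_cases p
    · exact (congrArg _ (congrArg _ (congrArg _ e0))).trans hi'.symm
    · exact (congrArg _ (congrArg _ (congrArg _ e1))).trans h21
    · exact (congrArg _ (congrArg _ (congrArg _ e2))).trans h21.symm
    · exact (congrArg _ (congrArg _ (congrArg _ e3))).trans hi'

/-- A non-zero root of the rep-polynomial gives a representation. -/
theorem exists_hom (hK : IsKnot ns) {r : ℂ} (hr : r ≠ 0) (h : aeval r (rawRepPoly ns o) = 0) :
    ∃ ρ : KnotGroup ns o →* SL2C,
      ∀ e, ρ (arc ns o e) = para (evalVec r (pieceVec ns o e)) := by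
  have hrel : ∀ w ∈ {w : FreeGroup (Piece ns) | IsRelator ns o w},
      FreeGroup.lift (fun e => para (evalVec r (pieceVec ns o e))) w = 1 := by
    intro w hw
    rcases hw with p | p | ⟨t, p, h₁, h₂⟩ | t | ⟨t, s, hs⟩
    · simp only [map_mul, map_inv, FreeGroup.lift_apply_of, pieceVec_zero, mul_inv_eq_one]
      fin_cases p <;> rfl
    · simp only [map_mul, map_inv, FreeGroup.lift_apply_of, pieceVec_last, mul_inv_eq_one]
      exact para_bottomVec hK hr h p
    · simp only [map_mul, map_inv, FreeGroup.lift_apply_of, mul_inv_eq_one]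
      rw [pieceVec_straight]
      · unfold Crossing.overPos; split_ifs <;> assumption
      · unfold Crossing.underPos; split_ifs <;> assumption
    · simp only [map_mul, map_inv, FreeGroup.lift_apply_of, mul_inv_eq_one]
      rw [pieceVec_over]
    · simp only [map_mul, map_inv, map_zpow, FreeGroup.lift_apply_of, mul_inv_eq_one]
      exact para_pieceVec_under r t s hs
  exact ⟨PresentedGroup.toGroup hrel, fun e => PresentedGroup.toGroup.of hrel⟩

/-- A non-zero root of the rep-polynomial gives a non-abelian parabolic representation. -/
theorem exists_parabolicRep (hK : IsKnot ns) {r : ℂ} (hr : r ≠ 0)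
    (h : aeval r (rawRepPoly ns o) = 0) :
    ∃ ρ : ParabolicRep ns o, ρ.1 (arc ns o (0, 0)) = para (1, 0) ∧
      ρ.1 (arc ns o (0, 2)) = para (0, r) := by
  obtain ⟨ρ, hρ⟩ := exists_hom hK hr h
  have h₁ : ρ (arc ns o (0, 0)) = para (1, 0) := by
    rw [hρ]; simp [pieceVec_zero, topVec, evalVec]
  have h₂ : ρ (arc ns o (0, 2)) = para (0, r) := by
    rw [hρ]; simp [pieceVec_zero, topVec, evalVec]
  refine ⟨⟨ρ, ?_, arc ns o (0, 0), arc ns o (0, 2), ?_⟩, h₁, h₂⟩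
  · rintro _ ⟨e, x, rfl⟩
    rw [map_mul, map_mul, map_inv, hρ, ← para_move, trace_para]
  · rw [h₁, h₂]
    intro hc
    have := congrArg (fun A : SL2C => A 0 0) hc
    simp [Matrix.mul_apply, coe_para, hr] at this

theorem trace_conj (A B : SL2C) : ((A * B * A⁻¹ : SL2C) : Matrix (Fin 2) (Fin 2) ℂ).trace =
    (B : Matrix (Fin 2) (Fin 2) ℂ).trace := by
  rw [Matrix.SpecialLinearGroup.coe_mul, Matrix.trace_mul_comm,
    ← Matrix.SpecialLinearGroup.coe_mul, inv_mul_cancel_left]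

/-- The parameter of a representation is unique up to sign. -/
theorem sq_eq_sq_of_conj {ρ σ : ParabolicRep ns o} {r s : ℂ} (hρσ : ρ ≈ σ)
    (h₁ : ρ.1 (arc ns o (0, 0)) = para (1, 0)) (h₂ : ρ.1 (arc ns o (0, 2)) = para (0, r))
    (h₃ : σ.1 (arc ns o (0, 0)) = para (1, 0)) (h₄ : σ.1 (arc ns o (0, 2)) = para (0, s)) :
    r ^ 2 = s ^ 2 := by
  obtain ⟨A, hA⟩ := hρσ
  -- The image of this product has trace `2 - r²`.
  have h := hA (arc ns o (0, 0) * arc ns o (0, 2))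
  rw [map_mul, map_mul, h₁, h₂, h₃, h₄] at h
  have := congrArg (fun B : SL2C => (B : Matrix (Fin 2) (Fin 2) ℂ).trace) h
  rw [trace_conj] at this
  simpa [Matrix.trace_fin_two, coe_para, Matrix.mul_apply] using this.symm

/-- Every non-abelian parabolic representation is conjugate to one in standard form. -/
theorem exists_standard (ρ : ParabolicRep ns o) :
    ∃ (σ : ParabolicRep ns o) (r : ℂ), r ≠ 0 ∧ σ ≈ ρ ∧ σ.1 (arc ns o (0, 0)) = para (1, 0) ∧
      σ.1 (arc ns o (0, 2)) = para (0, r) := by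
  have htr : ∀ e, (ρ.1 (arc ns o e) : Matrix (Fin 2) (Fin 2) ℂ).trace = 2 := fun e =>
    ρ.2.1 _ ⟨e, 1, by simp⟩
  obtain ⟨C, r, hr, h₁, h₂⟩ :=
    exists_conj_standard (htr (0, 0)) (htr (0, 2)) (bridges_not_commute ns o ρ.2.2)
  refine ⟨⟨(MulAut.conj C).toMonoidHom.comp ρ.1, ?_, ?_⟩, r, hr, ?_, h₁, h₂⟩
  · intro m hm
    have h3 : ((MulAut.conj C).toMonoidHom.comp ρ.1) m = C * ρ.1 m * C⁻¹ := rfl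
    rw [h3, trace_conj]
    exact ρ.2.1 m hm
  · obtain ⟨x, y, hxy⟩ := ρ.2.2
    refine ⟨x, y, fun h => hxy ?_⟩
    rw [← map_mul, ← map_mul] at h ⊢
    exact (MulAut.conj C).injective h
  · refine Setoid.symm ⟨C, fun x => rfl⟩

end Arcs

/-! ### The theorem -/

theorem repPoly_eq_of_eqSign {ns : List ℤ} {o : Orientation ns} {P : ℤ[X]}
    (hP : 0 < P.leadingCoeff) (h : EqSign (rawRepPoly ns o) P) : repPoly ns o = P := by
  unfold repPoly
  rcases h with h | h <;> rw [h]
  · rw [if_pos hP]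
  · rw [if_neg (by rw [leadingCoeff_neg]; omega), neg_neg]

theorem leadingCoeff_hat (g : ℤ[X]) : (hat g).leadingCoeff = g.leadingCoeff := by
  have h : (g.comp (-X)).leadingCoeff = (-1) ^ g.natDegree * g.leadingCoeff := by
    rw [leadingCoeff_comp (by simp)]; simp [mul_comm]
  have h1 : ((-1 : ℤ[X]) ^ g.natDegree) = C ((-1) ^ g.natDegree) := by simp
  rw [hat, h1, leadingCoeff_mul, h, leadingCoeff_C, ← mul_assoc, ← mul_pow]
  simp

theorem hat_eqSign (g : ℤ[X]) : EqSign (hat g) (g.comp (-X)) := by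
  unfold hat
  rcases neg_one_pow_eq_or ℤ[X] g.natDegree with h | h <;> rw [h] <;> simp [EqSign]

theorem aeval_hat_eq_zero_iff (g : ℤ[X]) (r : ℂ) :
    aeval r (hat g) = 0 ↔ aeval (-r) g = 0 := by
  have h : aeval r (g.comp (-X)) = aeval (-r) g := by
    rw [aeval_comp]; simp
  rcases hat_eqSign g with h' | h' <;> simp [h', h]

/-- The factor `g` of the rep-polynomial. -/
theorem exists_factor {ns : List ℤ} (hK : IsTwoBridgeKnot ns) (o : Orientation ns) :
    ∃ g : ℤ[X], EqSign (rawRepPoly ns o) (X * g * hat g) ∧ hat g ≠ g ∧ g ≠ 0 ∧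
      ∀ r : ℂ, aeval r g = 0 → aeval (-r) g ≠ 0 := by
  obtain ⟨f, h, hraw, hcop, hsymm⟩ := exists_factorization ns hK.2.1 o
  have hflip : EqSign ((h + f).comp (-X)) (h - f) := by
    rcases hsymm with ⟨h1, h2⟩ | ⟨h1, h2⟩
    · exact Or.inr (by rw [add_comp, h1, h2]; ring)
    · exact Or.inl (by rw [add_comp, h1, h2]; ring)
  have hhat : EqSign (hat (h + f)) (h - f) := (hat_eqSign _).trans hflip
  have hunit : ∀ a : ℤ[X], IsUnit a → EqSign (a * a) 1 := by
    intro a ha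
    obtain ⟨c, hc, rfl⟩ := Polynomial.isUnit_iff.1 ha
    rcases Int.isUnit_iff.1 hc with rfl | rfl <;> simp [EqSign]
  have hX := not_eqSign_rawRepPoly_X hK.2.2 o
  have hf : f ≠ 0 := by
    rintro rfl
    refine hX (hraw.trans ?_)
    simpa using (EqSign.refl X).mul (hunit h (isCoprime_zero_left.1 hcop))
  have hh : h ≠ 0 := by
    rintro rfl
    refine hX (hraw.trans ?_)
    simpa using ((EqSign.refl X).mul (hunit f (isCoprime_zero_right.1 hcop))).neg_left
  -- `h + f = h - f` would force `f = 0`, and `h + f = -(h - f)` would force `h = 0`.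
  have hne : hat (h + f) ≠ h + f := by
    intro heq
    rw [heq] at hhat
    rcases hhat with h1 | h1
    · exact hf (self_eq_neg.1 (by linear_combination h1))
    · exact hh (self_eq_neg.1 (by linear_combination h1))
  refine ⟨h + f, hraw.trans ?_, hne, ?_, ?_⟩
  · rw [← mul_assoc]; exact (EqSign.refl _).mul hhat.symm
  · intro h0; rw [h0] at hne; exact hne (by simp [hat])
  · intro r h1 h2
    rw [← aeval_hat_eq_zero_iff] at h2
    have h3 : aeval r (h - f) = 0 := by
      rcases hhat with h' | h' <;> rw [h'] at h2
      · exact h2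
      · rwa [map_neg, neg_eq_zero] at h2
    rw [map_add] at h1
    rw [map_sub] at h3
    obtain ⟨x, y, hxy⟩ := hcop
    have h4 := congrArg (aeval r) hxy
    simp only [map_add, map_mul, map_one] at h4
    have h5 : aeval r f = 0 := by linear_combination (h1 - h3) / 2
    have h6 : aeval r h = 0 := by linear_combination (h1 + h3) / 2
    rw [h5, h6] at h4
    simp at h4

end TwoBridge

theorem theorem5p1 (ns : List ℤ) (hK : TwoBridge.IsTwoBridgeKnot ns)
    (o : TwoBridge.Orientation ns) :
    ∃ g : Polynomial ℤ,
      TwoBridge.repPoly ns o = Polynomial.X * g * TwoBridge.hat g ∧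
      TwoBridge.hat g ≠ g ∧
      ∃ Φ : {r : ℂ // Polynomial.aeval r g = 0} ≃ TwoBridge.ParabolicRepClass ns o,
        ∀ r : {r : ℂ // Polynomial.aeval r g = 0},
          ∃ ρ : TwoBridge.ParabolicRep ns o,
            Φ r = Quotient.mk (TwoBridge.parabolicRepSetoid ns o) ρ ∧
            (ρ.1 (TwoBridge.arc ns o (0, 0)) : Matrix (Fin 2) (Fin 2) ℂ) = !![1, 1; 0, 1] ∧
            (ρ.1 (TwoBridge.arc ns o (0, 2)) : Matrix (Fin 2) (Fin 2) ℂ) =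
              !![1, 0; -(r : ℂ) ^ 2, 1] := by
  open TwoBridge in
  obtain ⟨g, hraw, hne, hg, hroots⟩ := exists_factor hK o
  have hr0 : ∀ r : ℂ, aeval r g = 0 → r ≠ 0 := by
    rintro r hr rfl
    exact hroots 0 hr (by simpa using hr)
  have hzero : ∀ r : ℂ, aeval r (rawRepPoly ns o) = 0 ↔
      r = 0 ∨ aeval r g = 0 ∨ aeval (-r) g = 0 := by
    intro r
    have : aeval r (rawRepPoly ns o) = 0 ↔ aeval r (X * g * hat g) = 0 := by
      rcases hraw with h | h <;> simp [h]
    rw [this, map_mul, map_mul, aeval_X, mul_eq_zero, mul_eq_zero, aeval_hat_eq_zero_iff,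
      or_assoc]
  have hrep : ∀ r : {r : ℂ // aeval r g = 0}, ∃ ρ : ParabolicRep ns o,
      ρ.1 (arc ns o (0, 0)) = para (1, 0) ∧ ρ.1 (arc ns o (0, 2)) = para (0, r) := fun r =>
    exists_parabolicRep hK.2.1 (hr0 _ r.2) ((hzero _).2 (Or.inr (Or.inl r.2)))
  choose ρ hρ₁ hρ₂ using hrep
  have hbij : Function.Bijective fun r : {r : ℂ // aeval r g = 0} =>
      (Quotient.mk (parabolicRepSetoid ns o) (ρ r) : ParabolicRepClass ns o) := by
    constructor
    · intro r s hrs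
      have h := sq_eq_sq_of_conj (Quotient.exact hrs) (hρ₁ r) (hρ₂ r) (hρ₁ s) (hρ₂ s)
      -- `r = -s` is impossible, since `g` has no two opposite roots.
      rcases sq_eq_sq_iff_eq_or_eq_neg.1 h with h | h
      · exact Subtype.ext h
      · exact absurd (h ▸ r.2) (hroots s s.2)
    · intro c
      obtain ⟨τ, rfl⟩ := Quotient.exists_rep c
      obtain ⟨σ, r, hr, hσ, h₁, h₂⟩ := exists_standard τ
      -- The parameter matters only up to sign, so a root of `ĝ` may be replaced by its negative.
      obtain ⟨s, hs, hs'⟩ : ∃ s : ℂ, aeval s g = 0 ∧ para (0, s) = para (0, r) := by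
        rcases (hzero r).1 (aeval_rawRepPoly_eq_zero h₁ h₂) with h | h | h
        · exact absurd h hr
        · exact ⟨r, h, rfl⟩
        · exact ⟨-r, h, para_eq_of_eqSign (Or.inr (by simp))⟩
      refine ⟨⟨s, hs⟩, Quotient.sound ?_⟩
      have : ρ ⟨s, hs⟩ = σ := Subtype.ext (hom_ext ns o (by rw [hρ₁, h₁]) (by rw [hρ₂, hs', h₂]))
      rw [this]
      exact hσ
  refine ⟨g, repPoly_eq_of_eqSign ?_ hraw, hne, Equiv.ofBijective _ hbij, fun r =>
    ⟨ρ r, rfl, ?_, ?_⟩⟩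
  · rw [leadingCoeff_mul, leadingCoeff_mul, leadingCoeff_X, one_mul, leadingCoeff_hat]
    exact mul_self_pos.2 (leadingCoeff_ne_zero.2 hg)
  · rw [hρ₁, coe_para]; simp
  · rw [hρ₂, coe_para]; simp
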